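/- **Conventions.** For $n\ge 1$ let the $n$-spiral be the set $S_n=\{l,r\}\times\mathbb{Z}/n!\;\cup\;\{m\}\times\{-n+1,\dots,n-1\}$ with the relation $R_n$ given by: $(l,k)\,R_n\,(l,k+1)$ and $(r,k)\,R_n\,(r,k+1)$ for $k\in\mathbb{Z}/n!$; $(m,k)\,R_n\,(m,k+1)$ for $-n+1\le k<n-1$; $(l,-n \bmod n!)\,R_n\,(m,-n+1)$; and $(m,n-1)\,R_n\,(r,n \bmod n!)$. Define $\xi_L,\xi_G,\xi_M:S_{n+1}\to S_n$ by $\xi_L(a,k)=(l,k \bmod n!)$, $\xi_G(a,k)=(r,k\bmod n!)$, and $\xi_M(a,k)=(a,k\bmod n!)$ for $a\in\{l,r\}$, $\xi_M(m,k)=(m,k)$ for $|k|<n$, $\xi_M(m,-n)=(l,-n\bmod n!)$, $\xi_M(m,n)=(r,n\bmod n!)$. Let $W_n$ be the discrete space that is the disjoint union of $6^n$ $n$-spirals indexed by the words of length $n$ in the letters $\xi_{L_1},\xi_{L_2},\xi_{M_1},\xi_{M_2},\xi_{G_1},\xi_{G_2}$, with $R_n$ the union of the relations of these spirals. The map $\xi:W_{n+1}\to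 W_n$ removes the last letter of the word and applies the corresponding one of $\xi_L,\xi_M,\xi_G$; its composites $W_{n+k}\to W_n$ are also denoted $\xi$. For a homeomorphism $\sigma$ of a compact space $X$, $\phi:(X,\sigma)\to(W_n,R_n)$ means a continuous surjection $\phi:X\to W_n$ with $\phi(x)\,R_n\,\phi(\sigma(x))$ for all $x\in X$, and $A_\phi=\{\phi^{-1}\{w\}: w\in W_n\}$. If $X$ is a Cantor set with a compatible metric, $(X,\sigma)$ has the *lifting property* if there is some $\phi:(X,\sigma)\to(W_n,R_n)$ with $n\ge1$, and for all $\epsilon>0$, $n\ge 1$ and $\phi:(X,\sigma)\to(W_n,R_n)$ there are $k\ge1$ and $\psi:(X,\sigma)\to(W_{n+k},R_{n+k})$ such that every member of $A_\psi$ has diameter less than $\epsilon$ and $\phi=\xi\circ\psi$. For a compact Hausdorff space $X$ in general, $(X,\sigma)$ has the *lifting property* if there is some $\phi:(X,\sigma)\to(W_n,R_n)$ with $n\ge1$, and for all $n\ge1$, $\phi:(X,\sigma)\to(W_n,R_n)$ and every partition $A$ of $X$ into nonempty clopen sets refining $A_\phi$ there are $k\ge1$ and $\psi:(X,\sigma)\to(W_{n+k},R_{n+k})$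 such that $A_\psi$ refines $A$ and $\phi=\xi\circ\psi$. (The two definitions agree on Cantor sets.) A homeomorphism $\sigma$ of $X$ induces the automorphism $f\mapsto f\circ\sigma$ of the C*-algebra $C(X)$ of complex continuous functions, also denoted $\sigma$. The ultrapower $(C(X),\sigma)^{\mathcal U}$ is the C*-algebra of bounded sequences in $C(X)$ modulo the sequences with $\lim_{\mathcal U}\|f_n\|=0$, with the automorphism $[f_n]\mapsto[\sigma(f_n)]$. A C*-algebra with automorphism $(A,\alpha)$ corresponds to $(Y,\tau)$ if it is isomorphic to $(C(Y),\tau)$. $T_{\mathrm{Cantor}\text{-}A}$ is the theory, in the continuous logic of unital C*-algebras with a function symbol for an automorphism, whose models are the pairs $(C(X),\sigma)$ with $X$ a nonempty compact zero-dimensional Hausdorff space without isolated points and $\sigma$ a homeomorphism of $X$. **Theorem.** Let $\sigma$ be a homeomorphism of a Cantor set $X$ such that $(X,\sigma)$ has the lifting property. Then for every nonprincipal ultrafilter $\mathcal U$ on $\mathbb N$, the ultrapower $(C(X),\sigma)^{\mathcal U}$ corresponds to a system $(Y,\tau)$, with $Y$ compact Hausdorff, zero-dimensional and without isolated points, that does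 not have the lifting property; moreover no system $(Y,\tau)$ on a compact Hausdorff space to which the ultrapower corresponds has the lifting property. **Corollary.** The lifting property is not axiomatizable over $T_{\mathrm{Cantor}\text{-}A}$: there is no set $T$ of sentences of continuous logic in the language of unital C*-algebras with an automorphism such that, for every model $(C(X),\sigma)$ of $T_{\mathrm{Cantor}\text{-}A}$, one has $(C(X),\sigma)\models T$ if and only if $(X,\sigma)$ has the lifting property. -/

import Mathlib

universe u v

open Filter Topology
open scoped BoundedContinuousFunction

noncomputable section

namespace CantorDynamics

/-! ### Spirals -/

/-- The set underlying the `n`-spiral: a left cycle and a right cycle of length `n!`, and a middle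
segment of `2n - 1` points indexed by the integers `-n < k < n`. -/
inductive Spiral (n : ℕ) : Type
  | l (k : ZMod n.factorial) : Spiral n
  | m (k : Set.Ioo (-(n : ℤ)) (n : ℤ)) : Spiral n
  | r (k : ZMod n.factorial) : Spiral n

/-- The relation of the `n`-spiral. Both cycles and the middle segment are traversed in increasing
order; the segment is entered from the point `-n mod n!` of the left cycle, and it leads to the
point `n mod n!` of the right cycle. -/
inductive Spiral.Rel (n : ℕ) : Spiral n → Spiral n → Prop
  | left (k : ZMod n.factorial) : Spiral.Rel n (.l k) (.l (k + 1))
  | right (k : ZMod n.factorial) : Spiral.Rel n (.r k) (.r (k + 1))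
  | middle (k k' : Set.Ioo (-(n : ℤ)) (n : ℤ)) (h : (k' : ℤ) = (k : ℤ) + 1) :
      Spiral.Rel n (.m k) (.m k')
  | enter (k : Set.Ioo (-(n : ℤ)) (n : ℤ)) (h : (k : ℤ) = -(n : ℤ) + 1) :
      Spiral.Rel n (.l (-(n : ZMod n.factorial))) (.m k)
  | exit (k : Set.Ioo (-(n : ℤ)) (n : ℤ)) (h : (k : ℤ) = (n : ℤ) - 1) :
      Spiral.Rel n (.m k) (.r (n : ZMod n.factorial))

/-- Reduction of residues modulo `(n+1)!` to residues modulo `n!`. -/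
def residue (n : ℕ) : ZMod (n + 1).factorial →+* ZMod n.factorial :=
  ZMod.castHom (Nat.factorial_dvd_factorial n.le_succ) (ZMod n.factorial)

/-- The position `k mod n!` of a point `(a, k)` of the `(n+1)`-spiral. -/
def Spiral.position {n : ℕ} : Spiral (n + 1) → ZMod n.factorial
  | .l k => residue n k
  | .m k => ((k : ℤ) : ZMod n.factorial)
  | .r k => residue n k

/-- `ξ_L (a, k) = (l, k mod n!)`. -/
def Spiral.xiL {n : ℕ} (x : Spiral (n + 1)) : Spiral n := .l x.position

/-- `ξ_G (a, k) = (r, k mod n!)`. -/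
def Spiral.xiG {n : ℕ} (x : Spiral (n + 1)) : Spiral n := .r x.position

/-- `ξ_M` projects the `(n+1)`-spiral straight down to the `n`-spiral: the two additional points
`(m, -n)` and `(m, n)` of the middle segment go to `(l, -n mod n!)` and `(r, n mod n!)`. -/
def Spiral.xiM {n : ℕ} : Spiral (n + 1) → Spiral n
  | .l k => .l (residue n k)
  | .m k =>
      if h : (k : ℤ) ∈ Set.Ioo (-(n : ℤ)) (n : ℤ) then .m ⟨k, h⟩
      else if (k : ℤ) ≤ -(n : ℤ) then .l ((k : ℤ) : ZMod n.factorial)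
      else .r ((k : ℤ) : ZMod n.factorial)
  | .r k => .r (residue n k)

/-- The six letters `ξ_{L_1}, ξ_{L_2}, ξ_{M_1}, ξ_{M_2}, ξ_{G_1}, ξ_{G_2}`. -/
inductive Letter : Type
  | L₁ | L₂ | M₁ | M₂ | G₁ | G₂

/-- The map of spirals named by a letter. -/
def Letter.map {n : ℕ} : Letter → Spiral (n + 1) → Spiral n
  | .L₁ => Spiral.xiL
  | .L₂ => Spiral.xiL
  | .M₁ => Spiral.xiM
  | .M₂ => Spiral.xiM
  | .G₁ => Spiral.xiG
  | .G₂ => Spiral.xiG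

/-- `W_n`: the disjoint union of `6 ^ n` copies of the `n`-spiral, indexed by the words of length
`n` in the six letters. -/
def W (n : ℕ) : Type := (Fin n → Letter) × Spiral n

/-- `W_n` is a discrete space. -/
instance (n : ℕ) : TopologicalSpace (W n) := ⊥

/-- The relation `R_n` on `W_n`: the union of the relations of the spirals. -/
def R (n : ℕ) (x y : W n) : Prop := x.1 = y.1 ∧ Spiral.Rel n x.2 y.2

/-- One step of the canonical map: the last letter of the word is removed, and the map of spirals
that it names is applied. -/
def xiStep (n : ℕ) (x : W (n + 1)) : W n :=
  (Fin.init x.1, (x.1 (Fin.last n)).map x.2)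

/-- The canonical map `ξ : W_{n+k} → W_n`. -/
def xi (n : ℕ) : (k : ℕ) → W (n + k) → W n
  | 0 => id
  | k + 1 => fun x => xi n k (xiStep (n + k) x)

/-! ### The lifting property -/

section Systems

variable {X : Type*}

/-- `φ : (X, σ) → (W_n, R_n)`: a continuous surjection with `φ(x) R_n φ(σ(x))` for all `x`. -/
def IsFactorMap [TopologicalSpace X] (σ : X ≃ₜ X) (n : ℕ) (φ : X → W n) : Prop :=
  Continuous φ ∧ Function.Surjective φ ∧ ∀ x, R n (φ x) (φ (σ x))

/-- The partition `A_φ` of `X` into the fibres of `φ`. -/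
def fibres {Y : Type*} (φ : X → Y) : Set (Set X) := Set.range fun y => φ ⁻¹' {y}

/-- A partition of `X` into nonempty clopen sets. -/
def IsClopenPartition [TopologicalSpace X] (A : Set (Set X)) : Prop :=
  Setoid.IsPartition A ∧ ∀ V ∈ A, IsClopen V

/-- `A` refines `B`: every cell of `A` lies in a cell of `B`. -/
def Refines (A B : Set (Set X)) : Prop := ∀ V ∈ A, ∃ V' ∈ B, V ⊆ V'

/-- The lifting property of a homeomorphism of a metric space (meant for Cantor sets): there is a
factor map onto some `(W_n, R_n)`, and every such factor map lifts through `ξ` to factor maps whose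
fibres have arbitrarily small diameter. -/
def LiftingProperty [MetricSpace X] (σ : X ≃ₜ X) : Prop :=
  (∃ n : ℕ, 1 ≤ n ∧ ∃ φ : X → W n, IsFactorMap σ n φ) ∧
  ∀ ε : ℝ, 0 < ε → ∀ n : ℕ, 1 ≤ n → ∀ φ : X → W n, IsFactorMap σ n φ →
    ∃ k : ℕ, 1 ≤ k ∧ ∃ ψ : X → W (n + k), IsFactorMap σ (n + k) ψ ∧
      (∀ V ∈ fibres ψ, Metric.diam V < ε) ∧ φ = xi n k ∘ ψ

/-- The lifting property in purely topological terms, for compact zero-dimensional spaces that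
need not be metrizable: smallness of the fibres is replaced by refinement of a given clopen
partition. -/
def TopLiftingProperty [TopologicalSpace X] (σ : X ≃ₜ X) : Prop :=
  (∃ n : ℕ, 1 ≤ n ∧ ∃ φ : X → W n, IsFactorMap σ n φ) ∧
  ∀ n : ℕ, 1 ≤ n → ∀ φ : X → W n, IsFactorMap σ n φ →
    ∀ A : Set (Set X), IsClopenPartition A → Refines A (fibres φ) →
      ∃ k : ℕ, 1 ≤ k ∧ ∃ ψ : X → W (n + k), IsFactorMap σ (n + k) ψ ∧
        Refines (fibres ψ) A ∧ φ = xi n k ∘ ψ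

end Systems

/-! ### Ultrapowers of commutative C⋆-algebras -/

section Ultrapower

variable {A : Type*} [CommCStarAlgebra A] (U : Ultrafilter ℕ)

/-- The ideal of the bounded sequences `a` in `A` with `lim_{n → U} ‖a n‖ = 0`. -/
def nullIdeal (A : Type*) [CommCStarAlgebra A] (U : Ultrafilter ℕ) : Ideal (ℕ →ᵇ A) where
  carrier := {a | Tendsto (fun n => ‖a n‖) U (𝓝 0)}
  zero_mem' := by simp
  add_mem' := by
    intro a b ha hb
    refine squeeze_zero (fun n => norm_nonneg _) (fun n => ?_) (by simpa using ha.add hb)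
    exact norm_add_le (a n) (b n)
  smul_mem' := by
    intro c a ha
    refine squeeze_zero (fun n => norm_nonneg _) (fun n => ?_) (by simpa using ha.const_mul ‖c‖)
    exact (norm_mul_le (c n) (a n)).trans
      (mul_le_mul_of_nonneg_right (c.norm_coe_le_norm n) (norm_nonneg _))

theorem mem_nullIdeal {a : ℕ →ᵇ A} :
    a ∈ nullIdeal A U ↔ Tendsto (fun n => ‖a n‖) U (𝓝 0) := Iff.rfl

/-- The ultrapower `A^U`: bounded sequences modulo those that tend to `0` along `U`. -/
abbrev Ultrapower (A : Type*) [CommCStarAlgebra A] (U : Ultrafilter ℕ) : Type _ :=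
  (ℕ →ᵇ A) ⧸ nullIdeal A U

theorem exists_tendsto_norm (a : ℕ →ᵇ A) :
    ∃ L : ℝ, Tendsto (fun n => ‖a n‖) U (𝓝 L) := by
  obtain ⟨L, -, hL⟩ := (isCompact_Icc (a := (0 : ℝ)) (b := ‖a‖)).ultrafilter_le_nhds
    (U.map fun n => ‖a n‖) (by
      rw [le_principal_iff]
      have h : ∀ᶠ n in (U : Filter ℕ), ‖a n‖ ∈ Set.Icc 0 ‖a‖ :=
        Filter.Eventually.of_forall fun n => ⟨norm_nonneg _, a.norm_coe_le_norm n⟩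
      exact h)
  exact ⟨L, hL⟩

/-- The norm of the ultrapower is the limit of the norms along `U`. -/
theorem tendsto_norm_mk (a : ℕ →ᵇ A) :
    Tendsto (fun n => ‖a n‖) U (𝓝 ‖Ideal.Quotient.mk (nullIdeal A U) a‖) := by
  obtain ⟨L, hL⟩ := exists_tendsto_norm U a
  suffices h : ‖Ideal.Quotient.mk (nullIdeal A U) a‖ = L by rwa [h]
  apply le_antisymm
  · refine le_of_forall_pos_le_add fun ε hε => ?_
    have hL0 : 0 ≤ L := ge_of_tendsto' hL fun n => norm_nonneg _
    have hs : ∀ᶠ n in (U : Filter ℕ), ‖a n‖ < L + ε := hL.eventually_lt_const (by linarith)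
    classical
    let b : ℕ →ᵇ A := BoundedContinuousFunction.ofNormedAddCommGroup
      (fun n => if ‖a n‖ < L + ε then a n else 0) continuous_of_discreteTopology (L + ε)
      (fun n => by
        split_ifs with h
        · exact h.le
        · rw [norm_zero]; positivity)
    have hb : Ideal.Quotient.mk (nullIdeal A U) a = Ideal.Quotient.mk (nullIdeal A U) b := by
      rw [Ideal.Quotient.eq, mem_nullIdeal]
      refine tendsto_const_nhds.congr' ?_
      filter_upwards [hs] with n hn
      simp [b, hn]
    rw [hb]
    refine (Ideal.Quotient.norm_mk_le _ b).trans ?_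
    exact BoundedContinuousFunction.norm_ofNormedAddCommGroup_le _ (by positivity) _
  · refine le_of_forall_pos_le_add fun ε hε => ?_
    obtain ⟨b, hb, hbn⟩ := Ideal.Quotient.norm_mk_lt (Ideal.Quotient.mk (nullIdeal A U) a) hε
    have hab : Tendsto (fun n => ‖(a - b) n‖) U (𝓝 0) := by
      rw [← mem_nullIdeal, ← Ideal.Quotient.eq, hb]
    refine le_of_tendsto_of_tendsto' hL
      (f := fun n => ‖a n‖) (g := fun n => ‖(a - b) n‖ + ‖b‖) (by simpa using hab.add_const ‖b‖)
      (fun n => ?_) |>.trans hbn.le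
    calc ‖a n‖ = ‖(a - b) n + b n‖ := by simp
      _ ≤ ‖(a - b) n‖ + ‖b n‖ := norm_add_le _ _
      _ ≤ ‖(a - b) n‖ + ‖b‖ := by gcongr; exact b.norm_coe_le_norm n

instance : IsClosed (nullIdeal A U : Set (ℕ →ᵇ A)) := by
  rw [← closure_subset_iff_isClosed]
  intro a ha
  have h0 : ‖Ideal.Quotient.mk (nullIdeal A U) a‖ = 0 :=
    (QuotientAddGroup.norm_mk_eq_zero_iff_mem_closure
      (S := (nullIdeal A U).toAddSubgroup) (m := a)).2 ha
  have h := tendsto_norm_mk U a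
  rwa [h0] at h

theorem star_mem_nullIdeal {a : ℕ →ᵇ A} (ha : a ∈ nullIdeal A U) : star a ∈ nullIdeal A U := by
  rw [mem_nullIdeal] at ha ⊢
  simpa using ha

/-- The involution of the ultrapower is `[a n] ↦ [star (a n)]`. -/
instance : Star (Ultrapower A U) where
  star := Quotient.map' star fun a b h => by
    rw [Submodule.quotientRel_def] at h ⊢
    rw [← star_sub]
    exact star_mem_nullIdeal U h

theorem star_mk (a : ℕ →ᵇ A) :
    star (Ideal.Quotient.mk (nullIdeal A U) a) = Ideal.Quotient.mk (nullIdeal A U) (star a) := rfl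

instance : StarRing (Ultrapower A U) where
  star_involutive x := by
    obtain ⟨a, rfl⟩ := Ideal.Quotient.mk_surjective x
    rw [star_mk, star_mk, star_star]
  star_mul x y := by
    obtain ⟨a, rfl⟩ := Ideal.Quotient.mk_surjective x
    obtain ⟨b, rfl⟩ := Ideal.Quotient.mk_surjective y
    rw [← map_mul, star_mk, star_mk, star_mk, star_mul, map_mul]
  star_add x y := by
    obtain ⟨a, rfl⟩ := Ideal.Quotient.mk_surjective x
    obtain ⟨b, rfl⟩ := Ideal.Quotient.mk_surjective y
    rw [← map_add, star_mk, star_mk, star_mk, star_add, map_add]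

/-- The ultrapower is a commutative unital C⋆-algebra. -/
instance : CommCStarAlgebra (Ultrapower A U) where
  norm_mul_self_le x := by
    obtain ⟨a, rfl⟩ := Ideal.Quotient.mk_surjective x
    have h1 := tendsto_norm_mk U a
    have h2 := tendsto_norm_mk U (star a * a)
    rw [star_mk, ← map_mul]
    refine (tendsto_nhds_unique (h1.mul h1) (h2.congr fun n => ?_)).le
    simpa using CStarRing.norm_star_mul_self (x := a n)
  star_smul c x := by
    obtain ⟨a, rfl⟩ := Ideal.Quotient.mk_surjective x
    change Ideal.Quotient.mk (nullIdeal A U) (star (c • a)) =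
      Ideal.Quotient.mk (nullIdeal A U) (star c • star a)
    rw [star_smul]

/-- A star-algebra automorphism of `A` acts termwise on bounded sequences. -/
def mapSeq (α : A ≃⋆ₐ[ℂ] A) : (ℕ →ᵇ A) →+* (ℕ →ᵇ A) where
  toFun a := BoundedContinuousFunction.ofNormedAddCommGroup (fun n => α (a n))
    continuous_of_discreteTopology ‖a‖
    (fun n => (StarAlgEquiv.norm_map α (a n)).le.trans (a.norm_coe_le_norm n))
  map_one' := by ext n; simp
  map_zero' := by ext n; simp
  map_mul' a b := by ext n; simp
  map_add' a b := by ext n; simp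

theorem mapSeq_mem (α : A ≃⋆ₐ[ℂ] A) :
    nullIdeal A U ≤ (nullIdeal A U).comap (mapSeq α) := by
  intro a ha
  rw [Ideal.mem_comap, mem_nullIdeal]
  rw [mem_nullIdeal] at ha
  exact ha.congr fun n => (StarAlgEquiv.norm_map α (a n)).symm

/-- The automorphism `[a n] ↦ [α (a n)]` of the ultrapower. -/
def ultrapowerAut (α : A ≃⋆ₐ[ℂ] A) : Ultrapower A U ≃⋆ₐ[ℂ] Ultrapower A U where
  toFun := Ideal.quotientMap (nullIdeal A U) (mapSeq α) (mapSeq_mem U α)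
  invFun := Ideal.quotientMap (nullIdeal A U) (mapSeq α.symm) (mapSeq_mem U α.symm)
  left_inv x := by
    obtain ⟨a, rfl⟩ := Ideal.Quotient.mk_surjective x
    rw [Ideal.quotientMap_mk, Ideal.quotientMap_mk]
    congr 1
    ext n
    exact α.symm_apply_apply (a n)
  right_inv x := by
    obtain ⟨a, rfl⟩ := Ideal.Quotient.mk_surjective x
    rw [Ideal.quotientMap_mk, Ideal.quotientMap_mk]
    congr 1
    ext n
    exact α.apply_symm_apply (a n)
  map_mul' := map_mul _
  map_add' := map_add _
  map_star' x := by
    obtain ⟨a, rfl⟩ := Ideal.Quotient.mk_surjective x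
    rw [star_mk, Ideal.quotientMap_mk, Ideal.quotientMap_mk, star_mk]
    congr 1
    ext n
    exact map_star α (a n)
  map_smul' c x := by
    obtain ⟨a, rfl⟩ := Ideal.Quotient.mk_surjective x
    change Ideal.Quotient.mk (nullIdeal A U) (mapSeq α (c • a)) =
      Ideal.Quotient.mk (nullIdeal A U) (c • mapSeq α a)
    congr 1
    ext n
    exact map_smul α c (a n)

end Ultrapower

/-! ### Gelfand duality for systems -/

section Duality

/-- The automorphism `f ↦ f ∘ σ` of `C(X)` induced by a homeomorphism `σ` of `X`. -/
def inducedAut {X : Type*} [TopologicalSpace X] [CompactSpace X] (σ : X ≃ₜ X) :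
    C(X, ℂ) ≃⋆ₐ[ℂ] C(X, ℂ) :=
  σ.compStarAlgEquiv' ℂ ℂ

/-- The pair `(A, α)` corresponds to the dynamical system `(Y, τ)`: it is isomorphic to
`C(Y)` with the automorphism induced by `τ`. -/
def CorrespondsTo {A : Type*} [CommCStarAlgebra A] (α : A ≃⋆ₐ[ℂ] A)
    {Y : Type*} [TopologicalSpace Y] [CompactSpace Y] (τ : Y ≃ₜ Y) : Prop :=
  ∃ e : A ≃⋆ₐ[ℂ] C(Y, ℂ), ∀ a, e (α a) = inducedAut τ (e a)

end Duality

/-! ### Continuous logic for C⋆-algebras with an automorphism -/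

section Logic

/-- Terms in `n` variables of the language of unital C⋆-algebras with a symbol `σ` for an
automorphism. -/
inductive Term (n : ℕ) : Type
  | var (i : Fin n) : Term n
  | zero : Term n
  | one : Term n
  | add (s t : Term n) : Term n
  | mul (s t : Term n) : Term n
  | smul (c : ℂ) (t : Term n) : Term n
  | star (t : Term n) : Term n
  | sigma (t : Term n) : Term n

/-- Formulas in `n` free variables: norms of terms, continuous real-valued connectives in finitely
many arguments, and the quantifiers `sup` and `inf` over the closed balls of integer radius (these
balls are the sorts of the structure). -/
inductive Formula : ℕ → Type
  | norm {n : ℕ} (t : Term n) : Formula n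
  | connective {n j : ℕ} (f : C(Fin j → ℝ, ℝ)) (φ : Fin j → Formula n) : Formula n
  | sup {n : ℕ} (N : ℕ) (φ : Formula (n + 1)) : Formula n
  | inf {n : ℕ} (N : ℕ) (φ : Formula (n + 1)) : Formula n

/-- A sentence is a formula without free variables. -/
abbrev Sentence : Type := Formula 0

variable {A : Type*} [CommCStarAlgebra A] (α : A ≃⋆ₐ[ℂ] A)

/-- The interpretation of a term in `(A, α)`. -/
def Term.eval {n : ℕ} (v : Fin n → A) : Term n → A
  | .var i => v i
  | .zero => 0
  | .one => 1
  | .add s t => s.eval v + t.eval v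
  | .mul s t => s.eval v * t.eval v
  | .smul c t => c • t.eval v
  | .star t => Star.star (t.eval v)
  | .sigma t => α (t.eval v)

/-- The interpretation of a formula in `(A, α)`. -/
def Formula.eval : {n : ℕ} → Formula n → (Fin n → A) → ℝ
  | _, .norm t, v => ‖t.eval α v‖
  | _, .connective f φ, v => f fun i => (φ i).eval v
  | _, .sup N φ, v => ⨆ a : Metric.closedBall (0 : A) N, φ.eval (Fin.snoc v (a : A))
  | _, .inf N φ, v => ⨅ a : Metric.closedBall (0 : A) N, φ.eval (Fin.snoc v (a : A))

/-- `(A, α)` is a model of the theory `T`: every sentence of `T` takes the value `0`. -/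
def Models (T : Set Sentence) : Prop := ∀ φ ∈ T, φ.eval α Fin.elim0 = 0

end Logic

/-- A property of dynamical systems is axiomatizable over the theory of the pairs `(C(X), σ)` with
`X` a compact zero-dimensional Hausdorff space without isolated points and `σ` an automorphism:
there is a theory `T` such that such a pair is a model of `T` if and only if the system `(X, σ)` has
the property. -/
def IsAxiomatizableOverCantorA
    (P : ∀ (X : Type u) [TopologicalSpace X], (X ≃ₜ X) → Prop) : Prop :=
  ∃ T : Set Sentence, ∀ (X : Type u) [TopologicalSpace X] [CompactSpace X] [T2Space X]
    [TotallyDisconnectedSpace X] [PerfectSpace X] [Nonempty X] (σ : X ≃ₜ X),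
    Models (inducedAut σ) T ↔ P X σ

end CantorDynamics

end

/-!
A factor map onto `W n` sends every orbit to a shift of one of three standard walks: around the
left cycle, through the middle segment, or around the right cycle. Each of them is eventually
periodic. Under the lifting property every clopen set is a union of fibres of a factor map, so each
orbit visits it at an eventually periodic set of times.

Conversely, an orbit which passes through a middle segment is infinite. So for each `i` there is a
clopen set `D i` which it visits, among the times `j ≤ i`, exactly at the squares. Along a
nonprincipal ultrafilter, the sets `D i` become one clopen subset of the space of the ultrapower,
which is visited by the limit point exactly at the square times; the lifting property fails.

By Łoś's theorem, a system and its ultrapower have the same theory. So the lifting property is not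
axiomatizable as soon as one system has it; the inverse limit of the `W n` does.
-/

noncomputable section

namespace CantorDynamics

theorem exists_intCast_eq_le {N : ℕ} [NeZero N] (k : ZMod N) (b : ℤ) :
    ∃ j ≤ b, (j : ZMod N) = k := by
  obtain ⟨i, rfl⟩ := ZMod.intCast_surjective k
  have hN : (N : ℤ) ≠ 0 := mod_cast NeZero.ne N
  refine ⟨b - (b - i) % N, by linarith [Int.emod_nonneg (b - i) hN], ?_⟩
  rw [Int.cast_sub, ZMod.intCast_mod, Int.cast_sub, sub_sub_cancel]

theorem exists_intCast_eq_ge {N : ℕ} [NeZero N] (k : ZMod N) (b : ℤ) :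
    ∃ j ≥ b, (j : ZMod N) = k := by
  obtain ⟨j, hj, h⟩ := exists_intCast_eq_le (-k) (-b)
  exact ⟨-j, le_neg.2 hj, by rw [Int.cast_neg, h, neg_neg]⟩

theorem intCast_eq_intCast_of_dvd {M N : ℕ} (hMN : M ∣ N) {i j : ℤ}
    (h : (i : ZMod N) = j) : (i : ZMod M) = j := by
  simpa only [map_intCast] using congrArg (ZMod.castHom hMN (ZMod M)) h

instance (n : ℕ) : NeZero n.factorial := ⟨n.factorial_ne_zero⟩

theorem residue_intCast (n : ℕ) (j : ℤ) :
    residue n (j : ZMod (n + 1).factorial) = (j : ZMod n.factorial) := map_intCast _ _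

namespace Spiral

variable {n : ℕ}

/-- The line of integers wrapped onto the `n`-spiral: it winds around the left cycle up to `-n`,
crosses the middle segment, and winds around the right cycle from `n` on. -/
def ofInt (n : ℕ) (j : ℤ) : Spiral n :=
  if h : j ∈ Set.Ioo (-(n : ℤ)) n then .m ⟨j, h⟩
  else if j ≤ -(n : ℤ) then .l j
  else .r j

theorem ofInt_of_mem {j : ℤ} (h : j ∈ Set.Ioo (-(n : ℤ)) n) : ofInt n j = .m ⟨j, h⟩ := dif_pos h

theorem ofInt_coe (k : Set.Ioo (-(n : ℤ)) (n : ℤ)) : ofInt n k = .m k := dif_pos k.2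

theorem ofInt_of_le {j : ℤ} (h : j ≤ -(n : ℤ)) : ofInt n j = .l j := by
  rw [ofInt, dif_neg fun h' => h'.1.not_ge h, if_pos h]

theorem ofInt_of_ge {j : ℤ} (h : (n : ℤ) ≤ j) (h' : -(n : ℤ) < j) : ofInt n j = .r j := by
  rw [ofInt, dif_neg fun h'' => h''.2.not_ge h, if_neg h'.not_ge]

theorem exists_ofInt_eq_l (k : ZMod n.factorial) (b : ℤ) :
    ∃ j ≤ b, j ≤ -(n : ℤ) ∧ (j : ZMod n.factorial) = k ∧ ofInt n j = .l k := by
  obtain ⟨j, hj, rfl⟩ := exists_intCast_eq_le k (min b (-n))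
  rw [le_min_iff] at hj
  exact ⟨j, hj.1, hj.2, rfl, ofInt_of_le hj.2⟩

theorem exists_ofInt_eq_r (hn : 1 ≤ n) (k : ZMod n.factorial) (b : ℤ) :
    ∃ j ≥ b, (n : ℤ) ≤ j ∧ (j : ZMod n.factorial) = k ∧ ofInt n j = .r k := by
  obtain ⟨j, hj, rfl⟩ := exists_intCast_eq_ge k (max b n)
  rw [ge_iff_le, max_le_iff] at hj
  exact ⟨j, hj.1, hj.2, rfl, ofInt_of_ge hj.2 (by omega)⟩

theorem ofInt_surjective (hn : 1 ≤ n) : Function.Surjective (ofInt n) := by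
  rintro (k | k | k)
  · obtain ⟨j, -, -, -, h⟩ := exists_ofInt_eq_l k 0
    exact ⟨j, h⟩
  · exact ⟨k, ofInt_coe k⟩
  · obtain ⟨j, -, -, -, h⟩ := exists_ofInt_eq_r hn k 0
    exact ⟨j, h⟩

theorem eq_or_of_ofInt_eq {i j : ℤ} (h : ofInt n i = ofInt n j) :
    i = j ∨ ((i : ZMod n.factorial) = j ∧
      ((i ≤ -(n : ℤ) ∧ j ≤ -(n : ℤ)) ∨ ((n : ℤ) ≤ i ∧ (n : ℤ) ≤ j))) := by
  unfold ofInt at h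
  split_ifs at h <;> simp only [Spiral.m.injEq, Spiral.l.injEq, Spiral.r.injEq, Subtype.mk.injEq,
    Set.mem_Ioo] at *
  · exact .inl h
  · exact .inr ⟨h, .inl ⟨by assumption, by assumption⟩⟩
  · exact .inr ⟨h, .inr ⟨by omega, by omega⟩⟩

theorem rel_ofInt (hn : 1 ≤ n) (j : ℤ) : Rel n (ofInt n j) (ofInt n (j + 1)) := by
  obtain h | rfl | h := lt_trichotomy j (-(n : ℤ))
  · rw [ofInt_of_le h.le, ofInt_of_le h, Int.cast_add, Int.cast_one]
    exact .left _
  · rw [ofInt_of_le le_rfl, ofInt_of_mem ⟨by omega, by omega⟩, Int.cast_neg, Int.cast_natCast]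
    exact .enter _ rfl
  obtain h' | h' | h' := lt_trichotomy (j + 1) (n : ℤ)
  · rw [ofInt_of_mem ⟨h, by omega⟩, ofInt_of_mem ⟨by omega, h'⟩]
    exact .middle _ _ rfl
  · rw [ofInt_of_mem ⟨h, by omega⟩, ofInt_of_ge h'.ge (by omega), h', Int.cast_natCast]
    exact .exit _ (eq_sub_of_add_eq h')
  · rw [ofInt_of_ge (by omega) h, ofInt_of_ge h'.le (by omega), Int.cast_add, Int.cast_one]
    exact .right _

theorem exists_ofInt_of_rel (hn : 1 ≤ n) {x y : Spiral n} (h : Rel n x y) :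
    ∃ j, x = ofInt n j ∧ y = ofInt n (j + 1) := by
  obtain k | k | ⟨k, k', h⟩ | ⟨k, h⟩ | ⟨k, h⟩ := h
  · obtain ⟨j, hj, -, rfl, h⟩ := exists_ofInt_eq_l k (-(n : ℤ) - 1)
    refine ⟨j, h.symm, ?_⟩
    rw [ofInt_of_le (by omega), Int.cast_add, Int.cast_one]
  · obtain ⟨j, -, hj, rfl, h⟩ := exists_ofInt_eq_r hn k 0
    refine ⟨j, h.symm, ?_⟩
    rw [ofInt_of_ge (by omega) (by omega), Int.cast_add, Int.cast_one]
  · exact ⟨k, (ofInt_coe k).symm, by rw [← h, ofInt_coe]⟩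
  · refine ⟨-(n : ℤ), ?_, by rw [← h, ofInt_coe]⟩
    rw [ofInt_of_le le_rfl, Int.cast_neg, Int.cast_natCast]
  · refine ⟨k, (ofInt_coe k).symm, ?_⟩
    rw [h, sub_add_cancel, ofInt_of_ge le_rfl (by omega), Int.cast_natCast]

theorem Rel.eq_ofInt_add_one (hn : 1 ≤ n) {j : ℤ} (hj : -(n : ℤ) < j) {y : Spiral n}
    (h : Rel n (ofInt n j) y) : y = ofInt n (j + 1) := by
  obtain ⟨i, hi, rfl⟩ := exists_ofInt_of_rel hn h
  obtain rfl | ⟨hij, h⟩ := eq_or_of_ofInt_eq hi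
  · rfl
  · rw [ofInt_of_ge (by omega) (by omega), ofInt_of_ge (by omega) (by omega), Int.cast_add,
      Int.cast_add, hij]

theorem Rel.eq_ofInt_sub_one (hn : 1 ≤ n) {j : ℤ} (hj : j < n) {x : Spiral n}
    (h : Rel n x (ofInt n j)) : x = ofInt n (j - 1) := by
  obtain ⟨i, rfl, hi⟩ := exists_ofInt_of_rel hn h
  obtain rfl | ⟨hij, h⟩ := eq_or_of_ofInt_eq hi
  · rw [add_sub_cancel_right]
  · rw [ofInt_of_le (by omega), ofInt_of_le (by omega), Int.cast_sub, hij, Int.cast_add,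
      add_sub_cancel_right]

theorem Rel.eq_l_or_eq_m_of_l {k : ZMod n.factorial} {y : Spiral n} (h : Rel n (.l k) y) :
    y = .l (k + 1) ∨ ∃ k', y = .m k' := by
  cases h
  exacts [.inl rfl, .inr ⟨_, rfl⟩]

theorem Rel.eq_l_of_l {k : ZMod n.factorial} {x : Spiral n} (h : Rel n x (.l k)) :
    x = .l (k - 1) := by
  cases h
  rw [add_sub_cancel_right]

theorem Rel.eq_r_of_r {k : ZMod n.factorial} {y : Spiral n} (h : Rel n (.r k) y) :
    y = .r (k + 1) := by
  cases h
  rfl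

theorem Rel.eq_r_or_eq_m_of_r {k : ZMod n.factorial} {x : Spiral n} (h : Rel n x (.r k)) :
    x = .r (k - 1) ∨ ∃ k', x = .m k' := by
  cases h
  · rw [add_sub_cancel_right]
    exact .inl rfl
  · exact .inr ⟨_, rfl⟩

theorem position_ofInt (n : ℕ) (j : ℤ) : (ofInt (n + 1) j).position = (j : ZMod n.factorial) := by
  unfold ofInt
  split_ifs
  · rfl
  · exact residue_intCast n j
  · exact residue_intCast n j

theorem xiM_ofInt (n : ℕ) (j : ℤ) : (ofInt (n + 1) j).xiM = ofInt n j := by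
  by_cases hl : j ≤ -((n + 1 : ℕ) : ℤ)
  · rw [ofInt_of_le hl, ofInt_of_le (by omega), xiM, residue_intCast]
  by_cases hr : ((n + 1 : ℕ) : ℤ) ≤ j
  · rw [ofInt_of_ge hr (by omega), ofInt_of_ge (by omega) (by omega), xiM, residue_intCast]
  · rw [ofInt_of_mem ⟨by omega, by omega⟩]
    rfl

end Spiral

/-! ### Bi-infinite walks -/

/-- The three ways in which a bi-infinite walk may run through a spiral: around the left cycle only,
through the middle segment, or around the right cycle only. -/
inductive Route : Type
  | left | through | right

/-- The standard walk along a route; every bi-infinite walk is a shift of a standard one. -/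
def Route.walk (n : ℕ) : Route → ℤ → Spiral n
  | .left, j => .l j
  | .through, j => .ofInt n j
  | .right, j => .r j

/-- Routes compose like the maps of spirals: a map which collapses a spiral onto a cycle does so
whatever it is applied to afterwards, and `through` is the route of the identity. -/
instance : Monoid Route where
  one := .through
  mul K T := match K with
    | .left => .left
    | .through => T
    | .right => .right
  one_mul _ := rfl
  mul_one K := by cases K <;> rfl
  mul_assoc K _ _ := by cases K <;> rfl

namespace Route

variable {n : ℕ}

theorem walk_one (j : ℤ) : (1 : Route).walk n j = .ofInt n j := rfl

theorem eq_one_of_walk_eq_m {T : Route} {j : ℤ} {k : Set.Ioo (-(n : ℤ)) (n : ℤ)}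
    (h : T.walk n j = .m k) : T = 1 := by
  cases T
  · simp [walk] at h
  · rfl
  · simp [walk] at h

theorem rel_walk (hn : 1 ≤ n) (T : Route) (j : ℤ) :
    Spiral.Rel n (T.walk n j) (T.walk n (j + 1)) := by
  cases T
  · rw [walk, walk, Int.cast_add, Int.cast_one]
    exact .left _
  · exact Spiral.rel_ofInt hn j
  · rw [walk, walk, Int.cast_add, Int.cast_one]
    exact .right _

theorem walk_add_eq_of_ofInt_eq {p N : ℕ} (hp : 1 ≤ p) (T : Route) {s : ℤ} (hs : |s| + p ≤ N)
    {i j : ℤ} (h : Spiral.ofInt N i = Spiral.ofInt N j) :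
    T.walk p (i + s) = T.walk p (j + s) := by
  obtain rfl | ⟨hij, h⟩ := Spiral.eq_or_of_ofInt_eq h
  · rfl
  obtain ⟨hs₁, hs₂⟩ := abs_le.1 (le_sub_iff_add_le.2 hs)
  have hp_dvd : p.factorial ∣ N.factorial := Nat.factorial_dvd_factorial (by omega)
  have hcast : ((i + s : ℤ) : ZMod p.factorial) = (j + s : ℤ) := by
    rw [Int.cast_add, Int.cast_add, intCast_eq_intCast_of_dvd hp_dvd hij]
  cases T
  · rw [walk, walk, hcast]
  · rw [walk, walk]
    obtain h | h := h
    · rw [Spiral.ofInt_of_le (by omega), Spiral.ofInt_of_le (by omega), hcast]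
    · rw [Spiral.ofInt_of_ge (by omega) (by omega), Spiral.ofInt_of_ge (by omega) (by omega),
        hcast]
  · rw [walk, walk, hcast]

end Route

namespace Spiral

variable {n : ℕ} {γ : ℤ → Spiral n}

theorem eq_ofInt_of_walk (hn : 1 ≤ n) (hγ : ∀ j, Rel n (γ j) (γ (j + 1))) {a : ℤ}
    {k : Set.Ioo (-(n : ℤ)) (n : ℤ)} (ha : γ a = .m k) (j : ℤ) :
    γ j = ofInt n (j + (k - a)) := by
  have hk := k.2
  rw [Set.mem_Ioo] at hk
  induction j using Int.inductionOn' (b := a) with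
  | zero => rw [add_sub_cancel, ofInt_coe, ha]
  | succ j hj ih =>
    have h := hγ j
    rw [ih] at h
    rw [h.eq_ofInt_add_one hn (by omega), add_right_comm]
  | pred j hj ih =>
    have h := hγ (j - 1)
    rw [sub_add_cancel, ih] at h
    rw [h.eq_ofInt_sub_one hn (by omega), add_sub_right_comm]

theorem eq_l_of_walk (hγ : ∀ j, Rel n (γ j) (γ (j + 1))) (hm : ∀ j k, γ j ≠ .m k) {i : ℤ}
    (h0 : γ 0 = .l i) (j : ℤ) : γ j = .l (j + i : ℤ) := by
  induction j using Int.inductionOn' (b := 0) with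
  | zero => rw [zero_add, h0]
  | succ j _ ih =>
    have h := hγ j
    rw [ih] at h
    obtain h | ⟨k, h⟩ := h.eq_l_or_eq_m_of_l
    · rw [h, add_right_comm, Int.cast_add (j + i), Int.cast_one]
    · exact absurd h (hm _ k)
  | pred j _ ih =>
    have h := hγ (j - 1)
    rw [sub_add_cancel, ih] at h
    rw [h.eq_l_of_l, sub_add_eq_add_sub, Int.cast_sub, Int.cast_one]

theorem eq_r_of_walk (hγ : ∀ j, Rel n (γ j) (γ (j + 1))) (hm : ∀ j k, γ j ≠ .m k) {i : ℤ}
    (h0 : γ 0 = .r i) (j : ℤ) : γ j = .r (j + i : ℤ) := by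
  induction j using Int.inductionOn' (b := 0) with
  | zero => rw [zero_add, h0]
  | succ j _ ih =>
    have h := hγ j
    rw [ih] at h
    rw [h.eq_r_of_r, add_right_comm, Int.cast_add (j + i), Int.cast_one]
  | pred j _ ih =>
    have h := hγ (j - 1)
    rw [sub_add_cancel, ih] at h
    obtain h | ⟨k, h⟩ := h.eq_r_or_eq_m_of_r
    · rw [h, sub_add_eq_add_sub, Int.cast_sub, Int.cast_one]
    · exact absurd h (hm _ k)

theorem exists_eq_walk (hn : 1 ≤ n) (hγ : ∀ j, Rel n (γ j) (γ (j + 1))) :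
    ∃ (K : Route) (s : ℤ), ∀ j, γ j = K.walk n (j + s) := by
  by_cases hm : ∃ a k, γ a = .m k
  · obtain ⟨a, k, ha⟩ := hm
    exact ⟨.through, k - a, eq_ofInt_of_walk hn hγ ha⟩
  push Not at hm
  rcases h0 : γ 0 with k | k | k
  · obtain ⟨i, rfl⟩ := ZMod.intCast_surjective k
    exact ⟨.left, i, eq_l_of_walk hγ hm h0⟩
  · exact absurd h0 (hm 0 k)
  · obtain ⟨i, rfl⟩ := ZMod.intCast_surjective k
    exact ⟨.right, i, eq_r_of_walk hγ hm h0⟩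

end Spiral

/-! ### Canonical maps and words -/

/-- Words in the six letters, the index set of the spirals of `W n`. -/
abbrev Word (n : ℕ) : Type := Fin n → Letter

/-- The route to which the map named by a letter sends the standard walk through the middle
segment. -/
def Letter.route : Letter → Route
  | .L₁ | .L₂ => .left
  | .M₁ | .M₂ => .through
  | .G₁ | .G₂ => .right

theorem Letter.exists_route_eq (T : Route) : ∃ a : Letter, a.route = T := by
  cases T
  exacts [⟨.L₁, rfl⟩, ⟨.M₁, rfl⟩, ⟨.G₁, rfl⟩]

theorem Letter.map_walk (a : Letter) (T : Route) (n : ℕ) (j : ℤ) :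
    a.map (T.walk (n + 1) j) = (a.route * T).walk n j := by
  cases T
  · cases a <;> exact congrArg _ (residue_intCast n j)
  · cases a
    · exact congrArg _ (Spiral.position_ofInt n j)
    · exact congrArg _ (Spiral.position_ofInt n j)
    · exact Spiral.xiM_ofInt n j
    · exact Spiral.xiM_ofInt n j
    · exact congrArg _ (Spiral.position_ofInt n j)
    · exact congrArg _ (Spiral.position_ofInt n j)
  · cases a <;> exact congrArg _ (residue_intCast n j)

theorem xiStep_walk (n : ℕ) (u : Word (n + 1)) (T : Route) (j : ℤ) :
    xiStep n (u, T.walk (n + 1) j) = (Fin.init u, ((u (Fin.last n)).route * T).walk n j) :=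
  Prod.ext rfl (Letter.map_walk _ _ _ _)

/-- A word, extended by one letter. -/
def Word.snoc {n : ℕ} (u : Word n) (a : Letter) : Word (n + 1) :=
  Fin.snoc (α := fun _ => Letter) u a

theorem Word.init_snoc {n : ℕ} (u : Word n) (a : Letter) :
    Fin.init (α := fun _ => Letter) (u.snoc a) = u := Fin.init_snoc _ _

theorem Word.snoc_last {n : ℕ} (u : Word n) (a : Letter) : u.snoc a (Fin.last n) = a :=
  Fin.snoc_last (α := fun _ => Letter) _ _

theorem Word.snoc_inj {n : ℕ} {u v : Word n} {a b : Letter} :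
    u.snoc a = v.snoc b ↔ u = v ∧ a = b := Fin.snoc_inj (α := fun _ => Letter)

/-- The effect of `xi n k` on the spiral of a word: the word to which it is truncated, and the route
to which the standard walk through the middle segment is sent. -/
def truncate (n : ℕ) : (k : ℕ) → Word (n + k) → Word n × Route
  | 0, u => (u, 1)
  | k + 1, u =>
    let c := truncate n k (Fin.init (n := n + k) (α := fun _ => Letter) u)
    (c.1, c.2 * (u (Fin.last (n + k))).route)

theorem truncate_snoc (n k : ℕ) (u : Word (n + k)) (a : Letter) :
    truncate n (k + 1) (u.snoc a) = ((truncate n k u).1, (truncate n k u).2 * a.route) := by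
  rw [truncate, Word.init_snoc, Word.snoc_last]

theorem xi_walk (n k : ℕ) (u : Word (n + k)) (T : Route) (j : ℤ) :
    xi n k (u, T.walk (n + k) j) =
      ((truncate n k u).1, ((truncate n k u).2 * T).walk n j) := by
  induction k generalizing T with
  | zero => rfl
  | succ k ih =>
    change xi n k (xiStep (n + k) (u, T.walk (n + k + 1) j)) = _
    rw [xiStep_walk, ih, ← mul_assoc]
    rfl

theorem xi_ofInt (n k : ℕ) (u : Word (n + k)) (j : ℤ) :
    xi n k (u, .ofInt (n + k) j) = ((truncate n k u).1, (truncate n k u).2.walk n j) := by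
  simpa only [Route.walk_one, mul_one] using xi_walk n k u 1 j

instance : Finite Letter :=
  Finite.of_surjective (![.L₁, .L₂, .M₁, .M₂, .G₁, .G₂] : Fin 6 → Letter) <| by
    rintro (_ | _)
    exacts [⟨0, rfl⟩, ⟨1, rfl⟩, ⟨2, rfl⟩, ⟨3, rfl⟩, ⟨4, rfl⟩, ⟨5, rfl⟩]

instance : Finite Route :=
  Finite.of_surjective Letter.route Letter.exists_route_eq

instance (n : ℕ) : Finite (Spiral n) :=
  Finite.of_surjective
    (Sum.elim .l (Sum.elim .m .r) : ZMod n.factorial ⊕ Set.Ioo (-(n : ℤ)) n ⊕ ZMod n.factorial → _)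
    fun
      | .l k => ⟨.inl k, rfl⟩
      | .m k => ⟨.inr (.inl k), rfl⟩
      | .r k => ⟨.inr (.inr k), rfl⟩

instance (n : ℕ) : Finite (W n) := inferInstanceAs (Finite (Word n × Spiral n))

theorem two_pow_le_card_truncate_eq (n k : ℕ) (c : Word n × Route) :
    2 ^ k ≤ Nat.card {u : Word (n + (k + 1)) // truncate n (k + 1) u = c} := by
  induction k with
  | zero =>
    obtain ⟨a, ha⟩ := Letter.exists_route_eq c.2
    have : Nonempty {u : Word (n + (0 + 1)) // truncate n (0 + 1) u = c} :=
      ⟨Word.snoc c.1 a, by rw [truncate_snoc, ha, truncate, one_mul]⟩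
    exact Nat.card_pos
  | succ k ih =>
    -- Appending a letter `M₁` or `M₂` does not change the class.
    let extend (p : {u : Word (n + (k + 1)) // truncate n (k + 1) u = c} × Bool) :
        {u : Word (n + (k + 1 + 1)) // truncate n (k + 1 + 1) u = c} :=
      ⟨Word.snoc p.1.1 (cond p.2 .M₁ .M₂), by
        obtain ⟨⟨u, rfl⟩, _ | _⟩ := p <;>
          exact (truncate_snoc n (k + 1) u _).trans (Prod.ext rfl (mul_one _))⟩
    have extend_injective : Function.Injective extend := by
      rintro ⟨⟨u, hu⟩, b⟩ ⟨⟨v, hv⟩, b'⟩ h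
      obtain ⟨rfl, hb⟩ := Word.snoc_inj.1 (congrArg Subtype.val h)
      cases b <;> cases b' <;> simp_all
    calc 2 ^ (k + 1) = 2 ^ k * 2 := pow_succ _ _
      _ ≤ Nat.card {u : Word (n + (k + 1)) // truncate n (k + 1) u = c} * 2 := by gcongr
      _ = Nat.card ({u : Word (n + (k + 1)) // truncate n (k + 1) u = c} × Bool) := by
        rw [Nat.card_prod, Nat.card_eq_fintype_card (α := Bool), Fintype.card_bool]
      _ ≤ _ := Nat.card_le_card_of_injective extend extend_injective

/-! ### Lifting morphisms through the canonical maps -/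

section Lifting

theorem exists_surjective_of_card_le {α β : Type*} [Finite α] [Finite β] [Nonempty β]
    (h : Nat.card β ≤ Nat.card α) : ∃ e : α → β, Function.Surjective e := by
  have := Fintype.ofFinite α
  have := Fintype.ofFinite β
  rw [Nat.card_eq_fintype_card, Nat.card_eq_fintype_card] at h
  obtain ⟨i⟩ := Function.Embedding.nonempty_of_card_le h
  exact ⟨_, Function.invFun_surjective i.injective⟩

theorem exists_surjective_comp_eq {α β γ : Type*} [Finite α] [Finite β] {a : α → γ} {b : β → γ}
    (hb : Function.Surjective b)
    (hcard : ∀ c, Nat.card {y // b y = c} ≤ Nat.card {x // a x = c}) :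
    ∃ g : α → β, Function.Surjective g ∧ ∀ x, b (g x) = a x := by
  have hfibre (c : γ) : ∃ e : {x // a x = c} → {y // b y = c}, Function.Surjective e := by
    obtain ⟨y, hy⟩ := hb c
    have : Nonempty {y // b y = c} := ⟨⟨y, hy⟩⟩
    exact exists_surjective_of_card_le (hcard c)
  choose e he using hfibre
  refine ⟨fun x => e (a x) ⟨x, rfl⟩, fun y => ?_, fun x => (e (a x) ⟨x, rfl⟩).2⟩
  obtain ⟨⟨x, hx⟩, hxy⟩ := he (b y) ⟨y, rfl⟩
  refine ⟨x, ?_⟩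
  have key (c : γ) (h : a x = c) : (e (a x) ⟨x, rfl⟩ : β) = e c ⟨x, h⟩ := by
    subst h
    rfl
  exact (key _ hx).trans (congrArg Subtype.val hxy)

variable {n p : ℕ}

theorem exists_apply_ofInt_eq (hn : 1 ≤ n) (hp : 1 ≤ p) (f : R p →r R n) (v : Word p) :
    ∃ (w : Word n) (K : Route) (s : ℤ), ∀ j, f (v, .ofInt p j) = (w, K.walk n (j + s)) := by
  have hstep (j : ℤ) : R n (f (v, .ofInt p j)) (f (v, .ofInt p (j + 1))) :=
    f.map_rel ⟨rfl, Spiral.rel_ofInt hp j⟩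
  obtain ⟨K, s, hK⟩ := Spiral.exists_eq_walk hn fun j => (hstep j).2
  have hword (j : ℤ) : (f (v, .ofInt p j)).1 = (f (v, .ofInt p 0)).1 := by
    induction j using Int.inductionOn' (b := 0) with
    | zero => rfl
    | succ i _ ih => rw [← (hstep i).1, ih]
    | pred i _ ih =>
      have h := (hstep (i - 1)).1
      rwa [sub_add_cancel, ih] at h
  exact ⟨_, K, s, fun j => Prod.ext (hword j) (hK j)⟩

theorem Route.apply_walk_eq (hn : 1 ≤ n) (hnp : n ≤ p) {F : Spiral p → Spiral n} {K : Route}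
    {s : ℤ} (hF : ∀ j, F (.ofInt p j) = K.walk n (j + s)) (T : Route) (j : ℤ) :
    F (T.walk p j) = (K * T).walk n (j + s) := by
  have hcast {i : ℤ} (h : (i : ZMod p.factorial) = j) :
      ((i + s : ℤ) : ZMod n.factorial) = (j + s : ℤ) := by
    rw [Int.cast_add, Int.cast_add, intCast_eq_intCast_of_dvd (Nat.factorial_dvd_factorial hnp) h]
  cases T
  · obtain ⟨i, hi, -, hij, h⟩ := Spiral.exists_ofInt_eq_l (n := p) j (-n - s)
    rw [walk, ← h, hF]
    cases K
    · exact congrArg Spiral.l (hcast hij)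
    · exact (Spiral.ofInt_of_le (by omega)).trans (congrArg _ (hcast hij))
    · exact congrArg Spiral.r (hcast hij)
  · exact (hF j).trans (congrArg (fun L : Route => L.walk n (j + s)) (mul_one K).symm)
  · obtain ⟨i, hi, -, hij, h⟩ := Spiral.exists_ofInt_eq_r (hn.trans hnp) j (n - s)
    rw [walk, ← h, hF]
    cases K
    · exact congrArg Spiral.l (hcast hij)
    · exact (Spiral.ofInt_of_ge (by omega) (by omega)).trans (congrArg _ (hcast hij))
    · exact congrArg Spiral.r (hcast hij)

theorem exists_apply_walk_eq (hn : 1 ≤ n) (hnp : n ≤ p) (f : R p →r R n) (v : Word p) :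
    ∃ (w : Word n) (K : Route) (s : ℤ), ∀ (T : Route) (j : ℤ),
      f (v, T.walk p j) = (w, (K * T).walk n (j + s)) := by
  obtain ⟨w, K, s, h⟩ := exists_apply_ofInt_eq hn (hn.trans hnp) f v
  have hword (x : Spiral p) : (f (v, x)).1 = w := by
    obtain ⟨j, rfl⟩ := Spiral.ofInt_surjective (hn.trans hnp) x
    rw [h]
  exact ⟨w, K, s, fun T j => Prod.ext (hword _)
    (Route.apply_walk_eq (F := fun x => (f (v, x)).2) hn hnp (fun j => by rw [h]) T j)⟩

theorem exists_relHom_of_walks {N : ℕ} (hp : 1 ≤ p) (hpN : p ≤ N) (v : Word N → Word p)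
    (T : Word N → Route) (s : Word N → ℤ) (hs : ∀ u, |s u| + p ≤ N) :
    ∃ h : R N →r R p, ∀ u j, h (u, .ofInt N j) = (v u, (T u).walk p (j + s u)) := by
  have hN := hp.trans hpN
  have hfactors (u : Word N) :
      Function.FactorsThrough (fun j => (T u).walk p (j + s u)) (Spiral.ofInt N) :=
    fun i j hij => (T u).walk_add_eq_of_ofInt_eq hp (hs u) hij
  have : Nonempty (Spiral p) := ⟨.l 0⟩
  choose g hg using fun u => (Function.factorsThrough_iff _).1 (hfactors u)
  have hg (u : Word N) (j : ℤ) : g u (.ofInt N j) = (T u).walk p (j + s u) :=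
    (congrFun (hg u) j).symm
  refine ⟨⟨fun x => (v x.1, g x.1 x.2), ?_⟩, fun u j => Prod.ext rfl (hg u j)⟩
  rintro ⟨u, x⟩ ⟨u', y⟩ ⟨rfl : u = u', hxy⟩
  obtain ⟨j, rfl, rfl⟩ := Spiral.exists_ofInt_of_rel hN hxy
  refine ⟨rfl, ?_⟩
  simpa only [hg, add_right_comm j 1] using (T u).rel_walk hp (j + s u)

theorem exists_comp_eq_xi (hn : 1 ≤ n) (hnp : n ≤ p) (f : R p →r R n)
    (hf : Function.Surjective f) :
    ∃ k, 1 ≤ k ∧ p ≤ n + k ∧ ∃ h : R (n + k) →r R p, Function.Surjective h ∧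
      ∀ x, f (h x) = xi n k x := by
  have hp := hn.trans hnp
  choose w K s hwalk using exists_apply_walk_eq hn hnp f
  -- Composing `f` with the standard walk along the route `c.2` in the spiral of the word `c.1`
  -- gives a walk of the same shape as `xi` does on a spiral whose word is truncated to
  -- `imageClass c`.
  let imageClass (c : Word p × Route) : Word n × Route := (w c.1, K c.1 * c.2)
  have imageClass_surjective : Function.Surjective imageClass := by
    intro c
    obtain ⟨⟨v, x⟩, hx⟩ := hf (c.1, .m ⟨0, by omega, by omega⟩)
    obtain ⟨i, rfl⟩ := Spiral.ofInt_surjective hp x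
    have h := (hwalk v 1 i).symm.trans hx
    have hK : K v * 1 = 1 := Route.eq_one_of_walk_eq_m (congrArg Prod.snd h)
    refine ⟨(v, c.2), Prod.ext (congrArg Prod.fst h :) ?_⟩
    rw [mul_one] at hK
    exact (congrArg (· * c.2) hK).trans (one_mul _)
  obtain ⟨M, hM⟩ := Finite.exists_le fun v => (s v).natAbs
  let k := Nat.card (Word p × Route) + (M + p)
  have hk (v : Word p) : |-s v| + p ≤ (n + (k + 1) : ℕ) := by
    have := hM v
    rw [abs_neg, Int.abs_eq_natAbs]
    omega
  obtain ⟨g, hg, hgc⟩ := exists_surjective_comp_eq (a := truncate n (k + 1)) imageClass_surjective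
    fun c => calc
      Nat.card {y // imageClass y = c} ≤ Nat.card (Word p × Route) := Finite.card_subtype_le _
      _ ≤ k := Nat.le_add_right _ _
      _ ≤ 2 ^ k := Nat.lt_two_pow_self.le
      _ ≤ _ := two_pow_le_card_truncate_eq n k c
  obtain ⟨h, hh⟩ := exists_relHom_of_walks hp (by omega : p ≤ n + (k + 1)) (fun u => (g u).1)
    (fun u => (g u).2) (fun u => -s (g u).1) fun u => hk _
  refine ⟨k + 1, by omega, by omega, h, ?_, ?_⟩
  · rintro ⟨v, x⟩
    obtain ⟨i, rfl⟩ := Spiral.ofInt_surjective hp x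
    obtain ⟨u, hu⟩ := hg (v, 1)
    exact ⟨(u, .ofInt _ (i + s v)), by rw [hh, hu, add_neg_cancel_right, Route.walk_one]⟩
  · rintro ⟨u, x⟩
    obtain ⟨j, rfl⟩ := Spiral.ofInt_surjective (by omega) x
    rw [hh, hwalk, neg_add_cancel_right, xi_ofInt, ← hgc]

end Lifting

/-! ### The inverse limit of the spirals -/

theorem Spiral.exists_walk_eq {n : ℕ} (x : Spiral n) : ∃ (T : Route) (j : ℤ), T.walk n j = x := by
  obtain k | k | k := x
  · obtain ⟨j, rfl⟩ := ZMod.intCast_surjective k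
    exact ⟨.left, j, rfl⟩
  · exact ⟨.through, k, Spiral.ofInt_coe k⟩
  · obtain ⟨j, rfl⟩ := ZMod.intCast_surjective k
    exact ⟨.right, j, rfl⟩

theorem xiStep_snoc_walk (n : ℕ) (u : Word n) {a : Letter} (ha : a.route = 1) (T : Route) (j : ℤ) :
    xiStep n (u.snoc a, T.walk (n + 1) j) = (u, T.walk n j) := by
  rw [xiStep_walk, Word.snoc_last, ha, one_mul]
  exact Prod.ext (u.init_snoc a) rfl

theorem exists_ne_xiStep_eq {n : ℕ} (a : W n) : ∃ b c, b ≠ c ∧ xiStep n b = a ∧ xiStep n c = a := by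
  obtain ⟨u, x⟩ := a
  obtain ⟨T, j, rfl⟩ := x.exists_walk_eq
  refine ⟨_, _, fun h => ?_, xiStep_snoc_walk n u (a := .M₁) rfl T j,
    xiStep_snoc_walk n u (a := .M₂) rfl T j⟩
  exact Letter.noConfusion (Word.snoc_inj.1 (congrArg Prod.fst h)).2

theorem xiStep_surjective (n : ℕ) : Function.Surjective (xiStep n) := fun a =>
  let ⟨b, _, _, hb, _⟩ := exists_ne_xiStep_eq a
  ⟨b, hb⟩

section

variable {n : ℕ} (hn : 1 ≤ n)
include hn

theorem R_iff_exists_ofInt {a b : W n} :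
    R n a b ↔ ∃ u j, a = (u, .ofInt n j) ∧ b = (u, .ofInt n (j + 1)) := by
  constructor
  · obtain ⟨u, x⟩ := a
    obtain ⟨v, y⟩ := b
    rintro ⟨rfl : u = v, h⟩
    obtain ⟨j, rfl, rfl⟩ := Spiral.exists_ofInt_of_rel hn h
    exact ⟨u, j, rfl, rfl⟩
  · rintro ⟨u, j, rfl, rfl⟩
    exact ⟨rfl, Spiral.rel_ofInt hn j⟩

theorem exists_R_right (a : W n) : ∃ b, R n a b := by
  obtain ⟨u, x⟩ := a
  obtain ⟨j, rfl⟩ := Spiral.ofInt_surjective hn x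
  exact ⟨_, (R_iff_exists_ofInt hn).2 ⟨u, j, rfl, rfl⟩⟩

theorem exists_R_left (b : W n) : ∃ a, R n a b := by
  obtain ⟨u, x⟩ := b
  obtain ⟨j, rfl⟩ := Spiral.ofInt_surjective hn x
  exact ⟨_, (R_iff_exists_ofInt hn).2 ⟨u, j - 1, rfl, by rw [sub_add_cancel]⟩⟩

theorem R.map_xiStep {a b : W (n + 1)} (h : R (n + 1) a b) : R n (xiStep n a) (xiStep n b) := by
  obtain ⟨u, j, rfl, rfl⟩ := (R_iff_exists_ofInt (by omega)).1 h
  rw [← Route.walk_one, ← Route.walk_one, xiStep_walk, xiStep_walk]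
  exact ⟨rfl, Route.rel_walk hn _ j⟩

theorem R.exists_lift {a b : W n} (h : R n a b) :
    ∃ a' b', R (n + 1) a' b' ∧ xiStep n a' = a ∧ xiStep n b' = b := by
  obtain ⟨u, j, rfl, rfl⟩ := (R_iff_exists_ofInt hn).1 h
  exact ⟨_, _, (R_iff_exists_ofInt (by omega)).2 ⟨Word.snoc u .M₁, j, rfl, rfl⟩,
    xiStep_snoc_walk n u (a := .M₁) rfl 1 j, xiStep_snoc_walk n u (a := .M₁) rfl 1 (j + 1)⟩

theorem xiStep_ofInt_add_eq (u : Word (n + 1)) {s : ℤ} (hs : |s| ≤ 1) {i j : ℤ}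
    (h : Spiral.ofInt (n + 1) i = .ofInt (n + 1) j) :
    xiStep n (u, .ofInt (n + 1) (i + s)) = xiStep n (u, .ofInt (n + 1) (j + s)) := by
  simp only [← Route.walk_one, xiStep_walk]
  exact Prod.ext rfl (Route.walk_add_eq_of_ofInt_eq hn _ (by push_cast; linarith) h)

theorem R.xiStep_right_unique {a b b' : W (n + 1)} (h : R (n + 1) a b) (h' : R (n + 1) a b') :
    xiStep n b = xiStep n b' := by
  obtain ⟨u, j, rfl, rfl⟩ := (R_iff_exists_ofInt (by omega)).1 h
  obtain ⟨v, i, hij, rfl⟩ := (R_iff_exists_ofInt (by omega)).1 h'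
  obtain rfl : u = v := congrArg Prod.fst hij
  exact xiStep_ofInt_add_eq hn u (by simp) (congrArg Prod.snd hij)

theorem R.xiStep_left_unique {a a' b : W (n + 1)} (h : R (n + 1) a b) (h' : R (n + 1) a' b) :
    xiStep n a = xiStep n a' := by
  obtain ⟨u, j, rfl, rfl⟩ := (R_iff_exists_ofInt (by omega)).1 h
  obtain ⟨v, i, rfl, hij⟩ := (R_iff_exists_ofInt (by omega)).1 h'
  obtain rfl : u = v := congrArg Prod.fst hij
  simpa only [add_neg_cancel_right] using
    xiStep_ofInt_add_eq hn u (s := -1) (by simp) (congrArg Prod.snd hij)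

end

theorem exists_compatible_seq {E : ℕ → Type*} (f : ∀ n, E (n + 1) → E n)
    (hf : ∀ n, Function.Surjective (f n)) (m : ℕ) (z : E m) :
    ∃ x : ∀ n, E n, x m = z ∧ ∀ n, f n (x (n + 1)) = x n := by
  induction m generalizing E with
  | zero =>
    choose s hs using hf
    exact ⟨fun n => Nat.rec z (fun n y => s n y) n, rfl, fun n => hs n _⟩
  | succ m ih =>
    obtain ⟨x, hx, hc⟩ := ih (E := fun n => E (n + 1)) (fun n => f (n + 1)) (fun n => hf (n + 1)) z
    refine ⟨fun n => Nat.casesOn n (f 0 (x 0)) x, hx, fun n => ?_⟩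
    cases n with
    | zero => rfl
    | succ n => exact hc n

/-- The inverse limit of the spaces `W n` under the canonical maps, a Cantor set on which the
relations `R n` converge to a homeomorphism with the lifting property. It is placed in an arbitrary
universe because axiomatizability refers to the spaces of one universe. -/
structure SpiralLimit : Type u where
  coord : ∀ n, W n
  xiStep_coord : ∀ n, xiStep n (coord (n + 1)) = coord n

namespace SpiralLimit

instance (n : ℕ) : DiscreteTopology (W n) := ⟨rfl⟩

instance : TopologicalSpace SpiralLimit.{u} := .induced coord inferInstance

theorem ext_coord {x y : SpiralLimit.{u}} (h : ∀ n, x.coord n = y.coord n) : x = y := by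
  cases x
  cases y
  congr 1
  exact funext h

theorem continuous_coord (n : ℕ) : Continuous fun x : SpiralLimit.{u} => x.coord n :=
  (continuous_apply n).comp continuous_induced_dom

theorem isClosedEmbedding_coord : IsClosedEmbedding (coord : SpiralLimit.{u} → ∀ n, W n) := by
  refine ⟨⟨⟨rfl⟩, fun x y h => ext_coord (congrFun h)⟩, ?_⟩
  have hrange : Set.range (coord : SpiralLimit.{u} → ∀ n, W n) =
      ⋂ n, {x | xiStep n (x (n + 1)) = x n} := by
    ext x
    simp only [Set.mem_range, Set.mem_iInter, Set.mem_ofPred_eq]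
    exact ⟨by rintro ⟨y, rfl⟩; exact y.xiStep_coord, fun h => ⟨⟨x, h⟩, rfl⟩⟩
  rw [hrange]
  exact isClosed_iInter fun n =>
    isClosed_eq ((continuous_of_discreteTopology (f := xiStep n)).comp (continuous_apply (n + 1)))
      (continuous_apply n)

instance : CompactSpace SpiralLimit.{u} := isClosedEmbedding_coord.compactSpace

instance : T2Space SpiralLimit.{u} := isClosedEmbedding_coord.isEmbedding.t2Space

instance : TotallyDisconnectedSpace SpiralLimit.{u} :=
  isClosedEmbedding_coord.isEmbedding.isTotallyDisconnected_range.1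
    (isTotallyDisconnected_of_totallyDisconnectedSpace _)

theorem coord_surjective (n : ℕ) : Function.Surjective fun x : SpiralLimit.{u} => x.coord n := by
  intro a
  obtain ⟨x, hx, hc⟩ := exists_compatible_seq xiStep xiStep_surjective n a
  exact ⟨⟨x, hc⟩, hx⟩

instance : Nonempty SpiralLimit.{u} :=
  have ⟨x, _⟩ := coord_surjective 0 (Fin.elim0, .l 0)
  ⟨x⟩

theorem xi_coord (x : SpiralLimit.{u}) (n k : ℕ) : xi n k (x.coord (n + k)) = x.coord n := by
  induction k with
  | zero => rfl
  | succ k ih =>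
    rw [← ih, ← x.xiStep_coord (n + k)]
    rfl

theorem coord_eq_of_le {x y : SpiralLimit.{u}} {m n : ℕ} (hmn : m ≤ n)
    (h : x.coord n = y.coord n) : x.coord m = y.coord m := by
  obtain ⟨k, rfl⟩ := Nat.exists_eq_add_of_le hmn
  rw [← xi_coord x, ← xi_coord y, h]

theorem exists_eq_of_coord_eq {β : Type*} {g : SpiralLimit.{u} → β} (hg : IsLocallyConstant g) :
    ∃ N, ∀ m ≥ N, ∀ x y, x.coord m = y.coord m → g x = g y := by
  by_contra! hcon
  let C (m : ℕ) : Set (SpiralLimit.{u} × SpiralLimit.{u}) :=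
    {p | p.1.coord m = p.2.coord m} ∩ {p | g p.1 ≠ g p.2}
  have hg_open : IsOpen {p : SpiralLimit.{u} × SpiralLimit.{u} | g p.1 = g p.2} :=
    ((hg.comp_continuous continuous_fst).prodMk (hg.comp_continuous continuous_snd))
      {q | q.1 = q.2}
  have hC_closed (m : ℕ) : IsClosed (C m) :=
    (isClosed_eq ((continuous_coord m).comp continuous_fst)
      ((continuous_coord m).comp continuous_snd)).inter hg_open.isClosed_compl
  have hC_nonempty (m : ℕ) : (C m).Nonempty := by
    obtain ⟨n, hn, x, y, hxy, hgxy⟩ := hcon m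
    exact ⟨(x, y), coord_eq_of_le hn hxy, hgxy⟩
  obtain ⟨p, hp⟩ := IsCompact.nonempty_iInter_of_sequence_nonempty_isCompact_isClosed C
    (fun m p hp => ⟨coord_eq_of_le m.le_succ hp.1, hp.2⟩) hC_nonempty (hC_closed 0).isCompact
    hC_closed
  rw [Set.mem_iInter] at hp
  exact (hp 0).2 (congrArg g (ext_coord fun n => (hp n).1))

instance : PerfectSpace SpiralLimit.{u} := by
  rw [perfectSpace_iff_forall_not_isolated]
  intro x
  by_contra hx
  rw [not_neBot, ← isOpen_singleton_iff_punctured_nhds] at hx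
  have hclopen : IsClopen {x} := ⟨isClosed_singleton, hx⟩
  obtain ⟨N, hN⟩ := exists_eq_of_coord_eq (LocallyConstant.charFn ℕ hclopen).isLocallyConstant
  have hN' (y : SpiralLimit.{u}) (hy : y.coord N = x.coord N) : y = x :=
    (LocallyConstant.charFn_eq_one ℕ y hclopen).1
      ((hN N le_rfl y x hy).trans ((LocallyConstant.charFn_eq_one ℕ x hclopen).2 rfl))
  obtain ⟨b, c, hne, hb, hc⟩ := exists_ne_xiStep_eq (x.coord N)
  obtain ⟨y, rfl⟩ := coord_surjective.{u} (N + 1) b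
  obtain ⟨z, rfl⟩ := coord_surjective.{u} (N + 1) c
  refine hne ?_
  simp only [hN' y ((y.xiStep_coord N).symm.trans hb), hN' z ((z.xiStep_coord N).symm.trans hc)]

/-- The values of `Q` on `W (n + 2)` determine a map into `W n` only after two applications of
`xiStep`, since uniqueness is not available on `W 0`. -/
theorem exists_continuous_of_rel (Q : ∀ n, W n → W n → Prop) (hex : ∀ n, 1 ≤ n → ∀ a, ∃ b, Q n a b)
    (hmap : ∀ n, 1 ≤ n → ∀ a b, Q (n + 1) a b → Q n (xiStep n a) (xiStep n b))
    (huniq : ∀ n, 1 ≤ n → ∀ a b c, Q (n + 1) a b → Q (n + 1) a c → xiStep n b = xiStep n c) :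
    ∃ F : SpiralLimit.{u} → SpiralLimit.{u}, Continuous F ∧
      ∀ x n, 1 ≤ n → Q n (x.coord n) ((F x).coord n) := by
  choose s hs using hex
  let F (x : SpiralLimit.{u}) : SpiralLimit.{u} :=
    { coord n := xiStep n (xiStep (n + 1) (s (n + 2) (by omega) (x.coord (n + 2))))
      xiStep_coord n := by
        congr 1
        refine huniq (n + 1) (by omega) (x.coord (n + 2)) _ _ ?_ (hs _ _ _)
        have h := hmap (n + 2) (by omega) _ _ (hs (n + 3) (by omega) (x.coord (n + 3)))
        rwa [x.xiStep_coord] at h }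
  refine ⟨F, continuous_induced_rng.2 (continuous_pi fun n => ?_), fun x n hn => ?_⟩
  · exact (continuous_of_discreteTopology
      (f := fun a => xiStep n (xiStep (n + 1) (s (n + 2) _ a)))).comp (continuous_coord (n + 2))
  · have h := hmap n hn _ _ (hmap (n + 1) (by omega) _ _
      (hs (n + 2) (by omega) (x.coord (n + 2))))
    rwa [x.xiStep_coord, x.xiStep_coord] at h

theorem exists_homeomorph_forall_R : ∃ σ : SpiralLimit.{u} ≃ₜ SpiralLimit.{u},
    ∀ x n, 1 ≤ n → R n (x.coord n) ((σ x).coord n) := by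
  obtain ⟨F, hF, hFR⟩ := exists_continuous_of_rel.{u} R (fun n hn => exists_R_right hn)
    (fun n hn a b h => h.map_xiStep hn) (fun n hn a b c h h' => h.xiStep_right_unique hn h')
  obtain ⟨G, hG, hGR⟩ := exists_continuous_of_rel.{u} (fun n a b => R n b a)
    (fun n hn => exists_R_left hn) (fun n hn a b h => h.map_xiStep hn)
    (fun n hn a b c h h' => h.xiStep_left_unique hn h')
  have eq_of_xiStep_eq {x y : SpiralLimit.{u}}
      (h : ∀ n, xiStep (n + 1) (x.coord (n + 2)) = xiStep (n + 1) (y.coord (n + 2))) : x = y := by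
    simp only [xiStep_coord] at h
    exact ext_coord fun n => coord_eq_of_le n.le_succ (h n)
  refine ⟨⟨⟨F, G, fun x => eq_of_xiStep_eq fun n => ?_, fun x => eq_of_xiStep_eq fun n => ?_⟩,
    hF, hG⟩, hFR⟩
  · exact (hGR (F x) (n + 2) (by omega)).xiStep_left_unique (by omega) (hFR x (n + 2) (by omega))
  · exact (hFR (G x) (n + 2) (by omega)).xiStep_right_unique (by omega) (hGR x (n + 2) (by omega))

/-- The homeomorphism of the inverse limit which is the limit of the relations `R n`. -/
def shift : SpiralLimit.{u} ≃ₜ SpiralLimit.{u} := exists_homeomorph_forall_R.choose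

theorem R_coord_shift {n : ℕ} (hn : 1 ≤ n) (x : SpiralLimit.{u}) :
    R n (x.coord n) ((shift x).coord n) := exists_homeomorph_forall_R.choose_spec x n hn

theorem exists_coord_eq_of_R {n : ℕ} (hn : 1 ≤ n) {a b : W n} (h : R n a b) :
    ∃ x : SpiralLimit.{u}, x.coord n = a ∧ (shift x).coord n = b := by
  obtain ⟨a', b', h', rfl, rfl⟩ := h.exists_lift hn
  obtain ⟨x, rfl⟩ := coord_surjective.{u} (n + 1) a'
  refine ⟨x, (x.xiStep_coord n).symm, ?_⟩
  rw [← xiStep_coord]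
  exact (R_coord_shift (by omega) x).xiStep_right_unique hn h'

theorem isFactorMap_comp_coord {m n : ℕ} (hm : 1 ≤ m) (f : R m →r R n)
    (hf : Function.Surjective f) : IsFactorMap shift n fun x : SpiralLimit.{u} => f (x.coord m) :=
  ⟨continuous_of_discreteTopology.comp (continuous_coord m), hf.comp (coord_surjective m),
    fun x => f.map_rel (R_coord_shift hm x)⟩

theorem exists_eq_comp_coord {m n : ℕ} (hm : 1 ≤ m) {φ : SpiralLimit.{u} → W n}
    (hφ : IsFactorMap shift n φ) (h : ∀ x y, x.coord m = y.coord m → φ x = φ y) :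
    ∃ f : R m →r R n, Function.Surjective f ∧ ∀ x, φ x = f (x.coord m) := by
  choose s hs using coord_surjective.{u} m
  have hfactor (x : SpiralLimit.{u}) : φ x = φ (s (x.coord m)) := h _ _ (hs _).symm
  refine ⟨⟨fun a => φ (s a), fun {a b} hab => ?_⟩, fun b => ?_, hfactor⟩
  · obtain ⟨x, rfl, rfl⟩ := exists_coord_eq_of_R hm hab
    rw [← hfactor, ← hfactor]
    exact hφ.2.2 x
  · obtain ⟨x, rfl⟩ := hφ.2.1 b
    exact ⟨x.coord m, (hfactor x).symm⟩

end SpiralLimit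

theorem IsClopenPartition.exists_isLocallyConstant {X : Type*} [TopologicalSpace X]
    {A : Set (Set X)} (hA : IsClopenPartition A) :
    ∃ cell : X → Set X, IsLocallyConstant cell ∧ ∀ x, cell x ∈ A ∧ x ∈ cell x := by
  choose cell hcell huniq using hA.1.2
  refine ⟨cell, ?_, hcell⟩
  rw [IsLocallyConstant.iff_exists_open]
  exact fun x => ⟨cell x, (hA.2 _ (hcell x).1).isOpen, (hcell x).2, fun y hy =>
    (huniq y (cell x) ⟨(hcell x).1, hy⟩).symm⟩

/-- A factor map `φ` of the limit is `f` composed with some `coord m`, and `f` completes to a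
factorization `f ∘ h = ξ`. Completing `h` in turn to `h ∘ q = ξ` makes `q` composed with a further
coordinate a lift of `φ`, which determines `coord m`. -/
theorem SpiralLimit.topLiftingProperty_shift : TopLiftingProperty shift.{u} := by
  refine ⟨⟨1, le_rfl, _, isFactorMap_comp_coord le_rfl (RelHom.id _) Function.surjective_id⟩, ?_⟩
  intro n hn φ hφ A hA _
  obtain ⟨cell, hcell_const, hcell⟩ := hA.exists_isLocallyConstant
  obtain ⟨N₁, hN₁⟩ := exists_eq_of_coord_eq ((IsLocallyConstant.iff_continuous φ).2 hφ.1)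
  obtain ⟨N₂, hN₂⟩ := exists_eq_of_coord_eq hcell_const
  obtain ⟨m, hm₁, hm₂, hnm⟩ : ∃ m, N₁ ≤ m ∧ N₂ ≤ m ∧ n ≤ m :=
    ⟨N₁ + N₂ + n, by omega, by omega, by omega⟩
  obtain ⟨f, hf, hφf⟩ := exists_eq_comp_coord (hn.trans hnm) hφ (hN₁ m hm₁)
  obtain ⟨k, hk, hmk, h, hh, hfh⟩ := exists_comp_eq_xi hn hnm f hf
  obtain ⟨j, -, -, q, hq, hhq⟩ := exists_comp_eq_xi (hn.trans hnm) hmk h hh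
  have hcoord (x : SpiralLimit.{u}) : h (q (x.coord (m + j))) = x.coord m := by
    rw [hhq, xi_coord]
  have hψ := isFactorMap_comp_coord.{u} (by omega) q hq
  refine ⟨k, hk, _, hψ, ?_, funext fun x => ?_⟩
  · rintro _ ⟨b, rfl⟩
    obtain ⟨x, rfl⟩ := hψ.2.1 b
    refine ⟨cell x, (hcell x).1, fun y hy => ?_⟩
    have hxy : y.coord m = x.coord m := by
      rw [← hcoord y, ← hcoord x]
      exact congrArg h hy
    rw [← hN₂ m hm₂ _ _ hxy]
    exact (hcell y).2
  · rw [hφf, ← hcoord x]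
    exact hfh _

/-! ### Itineraries -/

namespace Route

variable {n : ℕ}

theorem walk_add_factorial (T : Route) {j : ℤ} (hj : n ≤ j) (hj' : -(n : ℤ) < j) :
    T.walk n (j + n.factorial) = T.walk n j := by
  have hcast : ((j + n.factorial : ℤ) : ZMod n.factorial) = j := by
    rw [Int.cast_add, Int.cast_natCast, ZMod.natCast_self, add_zero]
  cases T
  · rw [walk, walk, hcast]
  · rw [walk, walk, Spiral.ofInt_of_ge (by omega) (by omega), Spiral.ofInt_of_ge hj hj', hcast]
  · rw [walk, walk, hcast]

end Route

section

variable {X : Type*} [TopologicalSpace X] {σ : X ≃ₜ X} {n : ℕ} {φ : X → W n}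

namespace IsFactorMap

theorem R_zpow (hφ : IsFactorMap σ n φ) (x : X) (j : ℤ) :
    R n (φ ((σ ^ j) x)) (φ ((σ ^ (j + 1)) x)) := by
  rw [add_comm, zpow_one_add]
  exact hφ.2.2 _

theorem exists_apply_zpow_eq (hφ : IsFactorMap σ n φ) (hn : 1 ≤ n) (x : X) :
    ∃ (u : Word n) (K : Route) (s : ℤ), ∀ j : ℤ, φ ((σ ^ j) x) = (u, K.walk n (j + s)) := by
  obtain ⟨K, s, h⟩ := Spiral.exists_eq_walk hn fun j => (hφ.R_zpow x j).2
  refine ⟨(φ x).1, K, s, fun j => Prod.ext ?_ (h j)⟩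
  induction j using Int.inductionOn' (b := 0) with
  | zero => rfl
  | succ j _ ih => exact (hφ.R_zpow x j).1.symm.trans ih
  | pred j _ ih =>
    have h := (hφ.R_zpow x (j - 1)).1
    rw [sub_add_cancel] at h
    exact h.trans ih

theorem eventually_periodic (hφ : IsFactorMap σ n φ) (hn : 1 ≤ n) (x : X) :
    ∃ J P : ℕ, 1 ≤ P ∧ ∀ j ≥ J, φ ((σ ^ (j + P)) x) = φ ((σ ^ j) x) := by
  obtain ⟨u, K, s, h⟩ := hφ.exists_apply_zpow_eq hn x
  refine ⟨n + s.natAbs, n.factorial, n.factorial_pos, fun j hj => ?_⟩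
  rw [← zpow_natCast, ← zpow_natCast, h, h, Nat.cast_add, add_right_comm,
    K.walk_add_factorial (by omega) (by omega)]

theorem exists_injective_pow (hφ : IsFactorMap σ n φ) (hn : 1 ≤ n) :
    ∃ x, Function.Injective fun j : ℕ => (σ ^ j) x := by
  have hmid : (0 : ℤ) ∈ Set.Ioo (-(n : ℤ)) n := ⟨by omega, by omega⟩
  obtain ⟨x, hx⟩ := hφ.2.1 (fun _ => .L₁, .m ⟨0, hmid⟩)
  have horbit (j : ℤ) : (φ ((σ ^ j) x)).2 = .ofInt n j := by
    have h := Spiral.eq_ofInt_of_walk hn (fun j => (hφ.R_zpow x j).2) (a := 0)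
      (congrArg Prod.snd hx) j
    simpa only [sub_self, add_zero] using h
  refine ⟨x, fun a b (h : (σ ^ a) x = (σ ^ b) x) => ?_⟩
  have hper : (σ ^ (a - b : ℤ)) x = (σ ^ (0 : ℤ)) x := by
    rw [sub_eq_neg_add, zpow_add, zpow_natCast, Homeomorph.mul_apply, h, zpow_neg, zpow_natCast]
    exact (σ ^ b).symm_apply_apply x
  have hplace : Spiral.ofInt n (a - b) = .ofInt n 0 := by rw [← horbit, ← horbit, hper]
  have := Spiral.eq_or_of_ofInt_eq hplace
  omega

end IsFactorMap

theorem TopLiftingProperty.eventually_periodic (h : TopLiftingProperty σ) {D : Set X}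
    (hD : IsClopen D) (x : X) :
    ∃ J P : ℕ, 1 ≤ P ∧ ∀ j ≥ J, ((σ ^ (j + P)) x ∈ D ↔ (σ ^ j) x ∈ D) := by
  obtain ⟨⟨n, hn, φ, hφ⟩, hlift⟩ := h
  let g (x : X) : W n × Prop := (φ x, x ∈ D)
  have hg_clopen (x : X) : IsClopen {z | g z = g x} := by
    have hfibre : IsClopen (φ ⁻¹' {φ x}) := (isClopen_discrete _).preimage hφ.1
    by_cases hx : x ∈ D
    · convert hfibre.inter hD using 1
      ext z
      simp [g, hx]
    · convert hfibre.inter hD.compl using 1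
      ext z
      simp [g, hx]
  obtain ⟨k, -, ψ, hψ, href, -⟩ := hlift n hn φ hφ (Setoid.ker g).classes
    ⟨Setoid.isPartition_classes _, by rintro _ ⟨x, rfl⟩; exact hg_clopen x⟩
    (by rintro _ ⟨x, rfl⟩; exact ⟨_, ⟨φ x, rfl⟩, fun z hz => congrArg Prod.fst hz⟩)
  obtain ⟨J, P, hP, hper⟩ := hψ.eventually_periodic (by omega) x
  refine ⟨J, P, hP, fun j hj => ?_⟩
  obtain ⟨_, ⟨z, rfl⟩, hz⟩ := href _ ⟨ψ ((σ ^ j) x), rfl⟩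
  have hcell : g ((σ ^ (j + P)) x) = g ((σ ^ j) x) := (hz (hper j hj)).trans (hz rfl).symm
  exact iff_of_eq (congrArg Prod.snd hcell)

end

theorem exists_not_isSquare_add_iff (J : ℕ) {P : ℕ} (hP : 1 ≤ P) :
    ∃ j ≥ J, ¬(IsSquare (j + P) ↔ IsSquare j) := by
  refine ⟨(J + P) * (J + P), by nlinarith, fun h => ?_⟩
  obtain ⟨r, hr⟩ := h.2 ⟨_, rfl⟩
  exact Nat.not_exists_sq (m := J + P) (n := (J + P) * (J + P) + P) (by omega) (by nlinarith)
    ⟨r, hr.symm⟩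

theorem exists_isClopen_forall_le_mem_iff {X : Type*} [TopologicalSpace X] [CompactSpace X]
    [T2Space X] [TotallyDisconnectedSpace X] {f : ℕ → X} (hf : Function.Injective f) (q : ℕ → Prop)
    (i : ℕ) :
    ∃ D : Set X, IsClopen D ∧ ∀ j ≤ i, (f j ∈ D ↔ q j) := by
  have hclosed (r : ℕ → Prop) : IsClosed (f '' {j | j ≤ i ∧ r j}) :=
    (((Set.finite_Iic i).subset fun j hj => hj.1).image f).isClosed
  obtain ⟨D, hD, hqD, hDq⟩ := exists_clopen_of_closed_subset_open (hclosed q)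
    (hclosed fun j => ¬q j).isOpen_compl (by
      rintro _ ⟨j, hj, rfl⟩ ⟨k, hk, h⟩
      obtain rfl := hf h
      exact hk.2 hj.2)
  refine ⟨D, hD, fun j hj => ⟨fun h => ?_, fun h => hqD ⟨j, ⟨hj, h⟩, rfl⟩⟩⟩
  by_contra hq
  exact hDq h ⟨j, ⟨hj, hq⟩, rfl⟩

/-! ### Ultralimits of points -/

theorem exists_forall_eq_apply {Y : Type*} [TopologicalSpace Y] [CompactSpace Y] [T2Space Y]
    (χ : C(Y, ℂ) →ₐ[ℂ] ℂ) : ∃ y, ∀ f, χ f = f y := by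
  obtain ⟨y, hy⟩ := (WeakDual.CharacterSpace.continuousMapEval_bijective (X := Y) (𝕜 := ℂ)).2
    (WeakDual.CharacterSpace.equivAlgHom.symm χ)
  exact ⟨y, fun f => (DFunLike.congr_fun hy f).symm⟩

theorem isClopen_setOf_eq_one {X R : Type*} [TopologicalSpace X] [TopologicalSpace R] [T1Space R]
    [MonoidWithZero R] [IsRightCancelMulZero R] [Nontrivial R] [ContinuousMul R] {p : C(X, R)}
    (hp : p * p = p) : IsClopen {x | p x = 1} := by
  have hcompl : {x | p x = 1}ᶜ = {x | p x = 0} := by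
    ext x
    have hx : p x * p x = p x := DFunLike.congr_fun hp x
    refine ⟨fun h => ?_, fun h h' => zero_ne_one (h.symm.trans h')⟩
    by_contra h0
    exact h (mul_right_cancel₀ h0 (hx.trans (one_mul _).symm))
  refine ⟨isClosed_singleton.preimage p.continuous, ?_⟩
  rw [← isClosed_compl_iff, hcompl]
  exact isClosed_singleton.preimage p.continuous

section

variable {X : Type*} [TopologicalSpace X] [CompactSpace X]

theorem exists_tendsto_apply (U : Ultrafilter ℕ) (a : ℕ →ᵇ C(X, ℂ)) (x : ℕ → X) :
    ∃ c, Tendsto (fun n => a n (x n)) U (𝓝 c) := by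
  have hball : ∀ᶠ n in (U : Filter ℕ), a n (x n) ∈ Metric.closedBall 0 ‖a‖ :=
    .of_forall fun n => mem_closedBall_zero_iff.2
      (((a n).norm_coe_le_norm (x n)).trans (a.norm_coe_le_norm n))
  obtain ⟨c, -, hc⟩ := (isCompact_closedBall (0 : ℂ) ‖a‖).ultrafilter_le_nhds'
    (U.map fun n => a n (x n)) hball
  exact ⟨c, hc⟩

theorem exists_algHom_forall_tendsto (U : Ultrafilter ℕ) (x : ℕ → X) :
    ∃ χ : Ultrapower C(X, ℂ) U →ₐ[ℂ] ℂ, ∀ a : ℕ →ᵇ C(X, ℂ),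
      Tendsto (fun n => a n (x n)) U (𝓝 (χ (Ideal.Quotient.mk _ a))) := by
  choose L hL using fun a => exists_tendsto_apply U a x
  have hL_eq {a c} (h : Tendsto (fun n => a n (x n)) U (𝓝 c)) : L a = c :=
    tendsto_nhds_unique (hL a) h
  let f : (ℕ →ᵇ C(X, ℂ)) →ₐ[ℂ] ℂ :=
    { toFun := L
      map_one' := hL_eq tendsto_const_nhds
      map_mul' := fun a b => hL_eq ((hL a).mul (hL b))
      map_zero' := hL_eq tendsto_const_nhds
      map_add' := fun a b => hL_eq ((hL a).add (hL b))
      commutes' := fun c => hL_eq tendsto_const_nhds }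
  exact ⟨Ideal.Quotient.liftₐ (nullIdeal C(X, ℂ) U) f fun a ha => hL_eq <|
    squeeze_zero_norm (fun n => (a n).norm_coe_le_norm (x n)) ha, hL⟩

/-- The sequence of the indicator functions of a sequence of clopen sets. -/
def indicatorSeq {D : ℕ → Set X} (hD : ∀ n, IsClopen (D n)) : ℕ →ᵇ C(X, ℂ) :=
  .ofNormedAddCommGroupDiscrete (fun n => (LocallyConstant.charFn ℂ (hD n) : C(X, ℂ))) 1 fun n =>
    (ContinuousMap.norm_le _ zero_le_one).2 fun x => by
      simpa [LocallyConstant.coe_charFn] using norm_indicator_le_norm_self (1 : X → ℂ) x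

theorem indicatorSeq_apply {D : ℕ → Set X} (hD : ∀ n, IsClopen (D n)) (n : ℕ) (x : X) :
    indicatorSeq hD n x = (D n).indicator 1 x :=
  congrFun (LocallyConstant.coe_charFn ℂ (hD n)) x

theorem indicatorSeq_mul_self {D : ℕ → Set X} (hD : ∀ n, IsClopen (D n)) :
    indicatorSeq hD * indicatorSeq hD = indicatorSeq hD := by
  ext n x
  change indicatorSeq hD n x * indicatorSeq hD n x = indicatorSeq hD n x
  by_cases hx : x ∈ D n <;> simp [indicatorSeq_apply, hx]

variable {U : Ultrafilter ℕ} {Y : Type*} [TopologicalSpace Y]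
  (e : Ultrapower C(X, ℂ) U ≃⋆ₐ[ℂ] C(Y, ℂ))

/-- The clopen subset of the space of the ultrapower that is given by a sequence of clopen sets:
where the class of their indicator functions is `1`. -/
def ultraClopen {D : ℕ → Set X} (hD : ∀ n, IsClopen (D n)) : Set Y :=
  {y | e (Ideal.Quotient.mk _ (indicatorSeq hD)) y = 1}

theorem isClopen_ultraClopen {D : ℕ → Set X} (hD : ∀ n, IsClopen (D n)) :
    IsClopen (ultraClopen e hD) :=
  isClopen_setOf_eq_one (by rw [← map_mul, ← map_mul, indicatorSeq_mul_self])

/-- The point `y` of the space of the ultrapower is the limit of the points `x n` along `U`: the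
character `a ↦ a y` of the ultrapower is the limit of the characters `a ↦ a (x n)`. -/
def IsUltralimit (x : ℕ → X) (y : Y) : Prop :=
  ∀ a : ℕ →ᵇ C(X, ℂ), Tendsto (fun n => a n (x n)) U (𝓝 (e (Ideal.Quotient.mk _ a) y))

theorem exists_isUltralimit [CompactSpace Y] [T2Space Y] (x : ℕ → X) : ∃ y, IsUltralimit e x y := by
  obtain ⟨χ, hχ⟩ := exists_algHom_forall_tendsto U x
  obtain ⟨y, hy⟩ := exists_forall_eq_apply (χ.comp (e.symm : C(Y, ℂ) →⋆ₐ[ℂ] _).toAlgHom)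
  refine ⟨y, fun a => ?_⟩
  have hay : e (Ideal.Quotient.mk _ a) y = χ (Ideal.Quotient.mk _ a) :=
    (hy _).symm.trans (congrArg χ (e.symm_apply_apply _))
  exact hay ▸ hχ a

namespace IsUltralimit

variable {e} {x : ℕ → X} {y : Y}

theorem mem_ultraClopen_iff (h : IsUltralimit e x y) {D : ℕ → Set X} (hD : ∀ n, IsClopen (D n)) :
    y ∈ ultraClopen e hD ↔ ∀ᶠ n in U, x n ∈ D n := by
  have hlim := h (indicatorSeq hD)
  simp only [indicatorSeq_apply] at hlim
  constructor
  · intro hy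
    rw [show e _ y = 1 from hy] at hlim
    filter_upwards [hlim.eventually_ne one_ne_zero] with n hn
    exact Set.mem_of_indicator_ne_zero hn
  · intro hx
    refine tendsto_nhds_unique hlim (tendsto_const_nhds.congr' ?_)
    filter_upwards [hx] with n hn
    exact (Set.indicator_of_mem hn 1).symm

theorem map [CompactSpace Y] {σ : X ≃ₜ X} {τ : Y ≃ₜ Y}
    (he : ∀ a, e (ultrapowerAut U (inducedAut σ) a) = inducedAut τ (e a))
    (h : IsUltralimit e x y) : IsUltralimit e (fun n => σ (x n)) (τ y) := fun a => by
  have hlim := h (mapSeq (inducedAut σ) a)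
  rwa [show e (Ideal.Quotient.mk _ (mapSeq (inducedAut σ) a)) y = e (Ideal.Quotient.mk _ a) (τ y)
    from DFunLike.congr_fun (he (Ideal.Quotient.mk _ a)) y] at hlim

theorem pow [CompactSpace Y] {σ : X ≃ₜ X} {τ : Y ≃ₜ Y}
    (he : ∀ a, e (ultrapowerAut U (inducedAut σ) a) = inducedAut τ (e a))
    (h : IsUltralimit e x y) (j : ℕ) : IsUltralimit e (fun n => (σ ^ j) (x n)) ((τ ^ j) y) := by
  induction j with
  | zero => exact h
  | succ j ih =>
    rw [pow_succ', pow_succ']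
    exact (ih.map he :)

end IsUltralimit

-- The point `y` visits the limit of clopen sets `D i` with `σ ^ j x ∈ D i ↔ IsSquare j` for all
-- `j ≤ i` exactly at the square times, and no clopen set with such an itinerary is compatible
-- with the lifting property.
theorem CorrespondsTo.not_topLiftingProperty [T2Space X] [TotallyDisconnectedSpace X] {σ : X ≃ₜ X}
    (hσ : ∃ n : ℕ, 1 ≤ n ∧ ∃ φ : X → W n, IsFactorMap σ n φ) (hU : ∀ n : ℕ, U ≠ pure n)
    [CompactSpace Y] [T2Space Y] {τ : Y ≃ₜ Y}
    (hτ : CorrespondsTo (ultrapowerAut U (inducedAut σ)) τ) : ¬TopLiftingProperty τ := by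
  intro hlift
  obtain ⟨n, hn, φ, hφ⟩ := hσ
  obtain ⟨x, hx⟩ := hφ.exists_injective_pow hn
  choose D hD hxD using exists_isClopen_forall_le_mem_iff hx IsSquare
  obtain ⟨e, he⟩ := hτ
  obtain ⟨y, hy⟩ := exists_isUltralimit e fun _ => x
  have hU_atTop : (U : Filter ℕ) ≤ atTop := Nat.cofinite_eq_atTop ▸
    U.le_cofinite_or_eq_pure.resolve_right fun ⟨n, h⟩ => hU n h
  have hitinerary (j : ℕ) : (τ ^ j) y ∈ ultraClopen e hD ↔ IsSquare j := by
    have hev : ∀ᶠ i in (U : Filter ℕ), ((σ ^ j) x ∈ D i ↔ IsSquare j) :=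
      hU_atTop ((eventually_ge_atTop j).mono fun i => hxD i j)
    rw [(hy.pow he j).mem_ultraClopen_iff hD, eventually_congr hev, eventually_const]
  obtain ⟨J, P, hP, hper⟩ := hlift.eventually_periodic (isClopen_ultraClopen e hD) y
  obtain ⟨j, hj, hne⟩ := exists_not_isSquare_add_iff J hP
  exact hne (by simpa only [hitinerary] using hper j hj)

end

/-! ### The space of an ultrapower -/

theorem exists_correspondsTo {A : Type*} [CommCStarAlgebra A] (α : A ≃⋆ₐ[ℂ] A) :
    ∃ τ : WeakDual.characterSpace ℂ A ≃ₜ WeakDual.characterSpace ℂ A, CorrespondsTo α τ := by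
  let F := WeakDual.CharacterSpace.compContinuousMap (α : A →⋆ₐ[ℂ] A)
  let G := WeakDual.CharacterSpace.compContinuousMap (α.symm : A →⋆ₐ[ℂ] A)
  refine ⟨⟨⟨F, G, fun χ => ?_, fun χ => ?_⟩, F.continuous, G.continuous⟩,
    gelfandStarTransform A, fun a => rfl⟩
  · ext a
    exact congrArg χ (α.apply_symm_apply a)
  · ext a
    exact congrArg χ (α.symm_apply_apply a)

theorem exists_continuousMap_eqOn_zero_eqOn_one {X : Type*} [TopologicalSpace X] [NormalSpace X]
    {s t : Set X} (hs : IsClosed s) (ht : IsClosed t) (hst : Disjoint s t) :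
    ∃ f : C(X, ℂ), Set.EqOn f 0 s ∧ Set.EqOn f 1 t := by
  obtain ⟨f, hf_zero, hf_one, -⟩ := exists_continuous_zero_one_of_isClosed hs ht hst
  refine ⟨⟨fun x => (f x : ℂ), by fun_prop⟩, fun x hx => ?_, fun x hx => ?_⟩
  · simp [hf_zero hx]
  · simp [hf_one hx]

section

variable {X : Type*} [TopologicalSpace X] [CompactSpace X] {U : Ultrafilter ℕ}
  {Y : Type*} [TopologicalSpace Y]

theorem exists_eq_apply_mk (e : Ultrapower C(X, ℂ) U ≃⋆ₐ[ℂ] C(Y, ℂ))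
    (f : C(Y, ℂ)) : ∃ a : ℕ →ᵇ C(X, ℂ), e (Ideal.Quotient.mk _ a) = f := by
  obtain ⟨a, ha⟩ := Ideal.Quotient.mk_surjective (e.symm f)
  exact ⟨a, ha ▸ e.apply_symm_apply f⟩

variable [Nonempty X] [CompactSpace Y] [T2Space Y]

theorem exists_norm_apply_eq_norm (f : C(X, ℂ)) : ∃ x, ‖f x‖ = ‖f‖ := by
  obtain ⟨x, -, hx⟩ := isCompact_univ.exists_isMaxOn Set.univ_nonempty
    f.continuous.norm.continuousOn
  exact ⟨x, (f.norm_coe_le_norm x).antisymm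
    ((ContinuousMap.norm_le _ (norm_nonneg _)).2 fun z => hx (Set.mem_univ z))⟩

theorem dense_setOf_isUltralimit (e : Ultrapower C(X, ℂ) U ≃⋆ₐ[ℂ] C(Y, ℂ)) :
    Dense {y | ∃ x, IsUltralimit e x y} := by
  rw [dense_iff_inter_open]
  rintro O hO ⟨y, hy⟩
  obtain ⟨f, hf_compl, hfy⟩ := exists_continuousMap_eqOn_zero_eqOn_one hO.isClosed_compl
    (isClosed_singleton (x := y)) (by simpa using hy)
  obtain ⟨a, rfl⟩ := exists_eq_apply_mk e f
  choose x hx using fun n => exists_norm_apply_eq_norm (a n)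
  obtain ⟨z, hz⟩ := exists_isUltralimit e x
  have hnorm : ‖e (Ideal.Quotient.mk _ a) z‖ = ‖e (Ideal.Quotient.mk _ a)‖ := by
    rw [StarAlgEquiv.norm_map]
    exact tendsto_nhds_unique (hz a).norm (by simpa only [hx] using tendsto_norm_mk U a)
  refine ⟨z, ?_, x, hz⟩
  by_contra hzO
  have hle := (e (Ideal.Quotient.mk _ a)).norm_coe_le_norm y
  rw [hfy rfl, ← hnorm, hf_compl hzO] at hle
  norm_num at hle

theorem exists_isClopen_between [T2Space X] [TotallyDisconnectedSpace X]
    (e : Ultrapower C(X, ℂ) U ≃⋆ₐ[ℂ] C(Y, ℂ)) (f : C(Y, ℂ)) {r s : ℝ}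
    (hrs : r < s) : ∃ D : Set Y, IsClopen D ∧ {y | ‖f y‖ < r} ⊆ D ∧ D ⊆ {y | ‖f y‖ ≤ s} := by
  obtain ⟨a, rfl⟩ := exists_eq_apply_mk e f
  choose D hD hrD hDs using fun n => exists_clopen_of_closed_subset_open
    (isClosed_le (a n).continuous.norm continuous_const)
    (isOpen_lt (a n).continuous.norm continuous_const)
    fun x (hx : ‖a n x‖ ≤ r) => hx.trans_lt hrs
  have hclopen := isClopen_ultraClopen e hD
  have hnorm := (e (Ideal.Quotient.mk _ a)).continuous.norm
  refine ⟨_, hclopen, fun y hy => ?_, fun y hy => ?_⟩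
  · by_contra hyD
    obtain ⟨z, ⟨x, hx⟩, hzr, hzD⟩ := (dense_setOf_isUltralimit e).exists_mem_open
      ((isOpen_lt hnorm continuous_const).inter hclopen.compl.isOpen) ⟨y, hy, hyD⟩
    refine hzD ((hx.mem_ultraClopen_iff hD).2 ?_)
    filter_upwards [(hx a).norm.eventually_lt_const hzr] with n hn
    exact hrD n hn.le
  · by_contra hys
    rw [Set.mem_ofPred_eq, not_le] at hys
    obtain ⟨z, ⟨x, hx⟩, hzs, hzD⟩ := (dense_setOf_isUltralimit e).exists_mem_open
      ((isOpen_lt continuous_const hnorm).inter hclopen.isOpen) ⟨y, hys, hy⟩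
    obtain ⟨n, hsn, hnD⟩ := (((hx a).norm.eventually_const_lt hzs).and
      ((hx.mem_ultraClopen_iff hD).1 hzD)).exists
    exact hsn.not_gt (hDs n hnD)

theorem totallyDisconnectedSpace_of_ultrapower [T2Space X] [TotallyDisconnectedSpace X]
    (e : Ultrapower C(X, ℂ) U ≃⋆ₐ[ℂ] C(Y, ℂ)) : TotallyDisconnectedSpace Y := by
  suffices TotallySeparatedSpace Y by infer_instance
  refine totallySeparatedSpace_iff_exists_isClopen.2 fun y₁ y₂ hne => ?_
  obtain ⟨f, hf₁, hf₂⟩ := exists_continuousMap_eqOn_zero_eqOn_one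
    (isClosed_singleton (x := y₁)) (isClosed_singleton (x := y₂)) (by simpa using hne)
  obtain ⟨D, hD, hfD, hDf⟩ := exists_isClopen_between e f (show (1 / 3 : ℝ) < 2 / 3 by norm_num)
  refine ⟨D, hD, hfD ?_, fun hy₂ => ?_⟩
  · norm_num [hf₁ rfl]
  · have := hDf hy₂
    norm_num [hf₂ rfl] at this

-- The clopen set `{y}` gives functions `a n` that are almost `1` at points `x n` with limit `y`,
-- hence also at points `z n ≠ x n`; the limit of the `z n` then lies in `{y}`, although clopen sets
-- separate it from that of the `x n`.
theorem perfectSpace_of_ultrapower [T2Space X] [TotallyDisconnectedSpace X] [PerfectSpace X]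
    (e : Ultrapower C(X, ℂ) U ≃⋆ₐ[ℂ] C(Y, ℂ)) : PerfectSpace Y := by
  rw [perfectSpace_iff_forall_not_isolated]
  intro y
  by_contra hy
  rw [Filter.not_neBot, ← isOpen_singleton_iff_punctured_nhds] at hy
  obtain ⟨y', ⟨x, hx⟩, hyy'⟩ := (dense_setOf_isUltralimit e).exists_mem_open hy ⟨y, rfl⟩
  obtain rfl : y' = y := hyy'
  obtain ⟨f, hf_ne, hfy⟩ := exists_continuousMap_eqOn_zero_eqOn_one hy.isClosed_compl
    (isClosed_singleton (x := y')) (by simp)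
  obtain ⟨a, rfl⟩ := exists_eq_apply_mk e f
  have hz (n : ℕ) : ∃ z, ‖a n (x n)‖ - 1 / 2 < ‖a n z‖ ∧ z ≠ x n := by
    have hnhds : ∀ᶠ z in 𝓝[≠] x n, ‖a n (x n)‖ - 1 / 2 < ‖a n z‖ :=
      (((a n).continuous.norm.tendsto (x n)).eventually_const_lt (by linarith)).filter_mono
        nhdsWithin_le_nhds
    exact (hnhds.and eventually_mem_nhdsWithin).exists
  choose z hza hzx using hz
  choose D hD hxD hzD using fun n => exists_isClopen_of_totally_separated (hzx n).symm
  obtain ⟨w, hw⟩ := exists_isUltralimit e z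
  have hwy : w = y' := by
    by_contra hne
    have hle := le_of_tendsto_of_tendsto' ((hx a).norm.sub_const (1 / 2)) (hw a).norm
      fun n => (hza n).le
    rw [hfy rfl, hf_ne hne] at hle
    norm_num at hle
  subst hwy
  obtain ⟨n, hn⟩ := ((hw.mem_ultraClopen_iff hD).1 ((hx.mem_ultraClopen_iff hD).2
    (.of_forall hxD))).exists
  exact hzD n hn

end

theorem exists_ultrapower_correspondsTo {X : Type u} [TopologicalSpace X] [CompactSpace X]
    [T2Space X] [TotallyDisconnectedSpace X] [PerfectSpace X] [Nonempty X] (σ : X ≃ₜ X)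
    (U : Ultrafilter ℕ) :
    ∃ (Y : Type u) (_ : TopologicalSpace Y) (_ : CompactSpace Y) (_ : T2Space Y)
      (_ : TotallyDisconnectedSpace Y) (_ : PerfectSpace Y) (_ : Nonempty Y) (τ : Y ≃ₜ Y),
      CorrespondsTo (ultrapowerAut U (inducedAut σ)) τ := by
  obtain ⟨τ, hτ⟩ := exists_correspondsTo (ultrapowerAut U (inducedAut σ))
  obtain ⟨e, -⟩ := id hτ
  obtain ⟨y, -⟩ := exists_isUltralimit e fun _ => Classical.arbitrary X
  exact ⟨_, inferInstance, inferInstance, inferInstance,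
    totallyDisconnectedSpace_of_ultrapower e, perfectSpace_of_ultrapower e, ⟨y⟩, τ, hτ⟩

/-! ### Łoś's theorem -/

section

variable {ι α : Type*} [ConditionallyCompleteLattice α] [Nonempty ι] {f : ι → α} {a b : α}

theorem iSup_mem_Icc (h : ∀ i, f i ∈ Set.Icc a b) : ⨆ i, f i ∈ Set.Icc a b :=
  ⟨(h (Classical.arbitrary ι)).1.trans
    (le_ciSup ⟨b, Set.forall_mem_range.2 fun i => (h i).2⟩ _), ciSup_le fun i => (h i).2⟩

theorem iInf_mem_Icc (h : ∀ i, f i ∈ Set.Icc a b) : ⨅ i, f i ∈ Set.Icc a b :=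
  (iSup_mem_Icc (α := αᵒᵈ) fun i => (h i).symm).symm

end

section

variable {κ ι ι' α : Type*} [ConditionallyCompleteLinearOrder α] [DenselyOrdered α]
  [TopologicalSpace α] [OrderTopology α] [Nonempty ι] [Nonempty ι'] {l : Filter κ}
  {f : κ → ι → α} {g : ι' → α}

theorem tendsto_iSup_of_forall_tendsto (hf : ∀ k, BddAbove (Set.range (f k)))
    (hg : BddAbove (Set.range g)) (h : ∀ s : κ → ι, ∃ j, Tendsto (fun k => f k (s k)) l (𝓝 (g j)))
    (h' : ∀ j, ∃ s : κ → ι, Tendsto (fun k => f k (s k)) l (𝓝 (g j))) :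
    Tendsto (fun k => ⨆ i, f k i) l (𝓝 (⨆ j, g j)) := by
  refine tendsto_order.2 ⟨fun c hc => ?_, fun c hc => ?_⟩
  · obtain ⟨j, hj⟩ := exists_lt_of_lt_ciSup hc
    obtain ⟨s, hs⟩ := h' j
    filter_upwards [hs.eventually_const_lt hj] with k hk
    exact hk.trans_le (le_ciSup (hf k) (s k))
  · obtain ⟨d, hgd, hdc⟩ := exists_between hc
    have hex (k : κ) : ∃ i, (∃ i', d < f k i') → d < f k i := by
      by_cases hk : ∃ i', d < f k i'
      · exact hk.imp fun i hi _ => hi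
      · exact ⟨Classical.arbitrary ι, fun hk' => absurd hk' hk⟩
    choose s hs using hex
    obtain ⟨j, hj⟩ := h s
    filter_upwards [hj.eventually_lt_const ((le_ciSup hg j).trans_lt hgd)] with k hk
    refine (ciSup_le fun i => ?_).trans_lt hdc
    exact le_of_not_gt fun hi => hk.not_gt (hs k ⟨i, hi⟩)

theorem tendsto_iInf_of_forall_tendsto (hf : ∀ k, BddBelow (Set.range (f k)))
    (hg : BddBelow (Set.range g)) (h : ∀ s : κ → ι, ∃ j, Tendsto (fun k => f k (s k)) l (𝓝 (g j)))
    (h' : ∀ j, ∃ s : κ → ι, Tendsto (fun k => f k (s k)) l (𝓝 (g j))) :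
    Tendsto (fun k => ⨅ i, f k i) l (𝓝 (⨅ j, g j)) :=
  tendsto_iSup_of_forall_tendsto (α := αᵒᵈ) hf hg h h'

end

instance (A : Type*) [SeminormedAddCommGroup A] (N : ℕ) :
    Nonempty (Metric.closedBall (0 : A) N) :=
  ⟨⟨0, Metric.mem_closedBall_self N.cast_nonneg⟩⟩

theorem norm_snoc_le {A : Type*} [SeminormedAddCommGroup A] {n : ℕ} {v : Fin n → A} {r : ℝ}
    (hv : ∀ i, ‖v i‖ ≤ r) {N : ℕ} (a : Metric.closedBall (0 : A) N) (i : Fin (n + 1)) :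
    ‖(Fin.snoc v (a : A) : Fin (n + 1) → A) i‖ ≤ max r N := by
  refine Fin.lastCases ?_ (fun i => ?_) i
  · rw [Fin.snoc_last]
    exact (mem_closedBall_zero_iff.1 a.2).trans (le_max_right _ _)
  · rw [Fin.snoc_castSucc]
    exact (hv i).trans (le_max_left _ _)

theorem Term.eval_comp {A B : Type*} [CommCStarAlgebra A] [CommCStarAlgebra B] {α : A ≃⋆ₐ[ℂ] A}
    {β : B ≃⋆ₐ[ℂ] B} (f : A →⋆ₐ[ℂ] B) (hf : ∀ a, f (α a) = β (f a)) {n : ℕ} (t : Term n)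
    (v : Fin n → A) : t.eval β (f ∘ v) = f (t.eval α v) := by
  induction t with
  | var i => rfl
  | zero => exact (map_zero f).symm
  | one => exact (map_one f).symm
  | add s t hs ht => simp only [Term.eval, hs, ht, map_add]
  | mul s t hs ht => simp only [Term.eval, hs, ht, map_mul]
  | smul c t ht => simp only [Term.eval, ht, map_smul]
  | star t ht => simp only [Term.eval, ht, map_star]
  | sigma t ht => simp only [Term.eval, ht, hf]

section

variable {A : Type*} [CommCStarAlgebra A] (α : A ≃⋆ₐ[ℂ] A) (U : Ultrafilter ℕ)

/-- The automorphism `(a n) ↦ (α (a n))` of the algebra of bounded sequences; it makes evaluation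
at an index and the quotient map to the ultrapower homomorphisms of algebras with automorphism. -/
def seqAut : (ℕ →ᵇ A) ≃⋆ₐ[ℂ] (ℕ →ᵇ A) where
  toFun := mapSeq α
  invFun := mapSeq α.symm
  left_inv a := BoundedContinuousFunction.ext fun n => α.symm_apply_apply (a n)
  right_inv a := BoundedContinuousFunction.ext fun n => α.apply_symm_apply (a n)
  map_mul' := map_mul _
  map_add' := map_add _
  map_star' a := BoundedContinuousFunction.ext fun n => map_star α (a n)
  map_smul' c a := BoundedContinuousFunction.ext fun n => map_smul α c (a n)

/-- Evaluation of bounded sequences at an index, as a homomorphism of star-algebras. -/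
def seqEval (k : ℕ) : (ℕ →ᵇ A) →⋆ₐ[ℂ] A where
  toFun a := a k
  map_one' := rfl
  map_mul' _ _ := rfl
  map_zero' := rfl
  map_add' _ _ := rfl
  commutes' _ := rfl
  map_star' _ := rfl

/-- The class of a bounded sequence in the ultrapower, as a homomorphism of star-algebras. -/
def ultraMk : (ℕ →ᵇ A) →⋆ₐ[ℂ] Ultrapower A U where
  toAlgHom := Ideal.Quotient.mkₐ ℂ (nullIdeal A U)
  map_star' _ := rfl

variable {U} in
theorem norm_ultraMk_le {a : ℕ →ᵇ A} {r : ℝ} (h : ∀ k, ‖a k‖ ≤ r) : ‖ultraMk U a‖ ≤ r :=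
  le_of_tendsto' (tendsto_norm_mk U a) h

theorem exists_norm_le_norm_sub_le {E : Type*} [SeminormedAddCommGroup E] [NormedSpace ℝ E] (a : E)
    {r : ℝ} (hr : 0 ≤ r) : ∃ b : E, ‖b‖ ≤ r ∧ ‖a - b‖ ≤ max (‖a‖ - r) 0 := by
  obtain h | h := le_or_gt ‖a‖ r
  · exact ⟨a, h, by simp⟩
  have ha : 0 < ‖a‖ := hr.trans_lt h
  have hdiv : r / ‖a‖ ≤ 1 := (div_le_one ha).2 h.le
  have hsub : a - (r / ‖a‖) • a = (1 - r / ‖a‖) • a := by rw [sub_smul, one_smul]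
  refine ⟨(r / ‖a‖) • a, ?_, le_max_of_le_left ?_⟩
  · rw [norm_smul_of_nonneg (by positivity), div_mul_cancel₀ _ ha.ne']
  · rw [hsub, norm_smul_of_nonneg (sub_nonneg.2 hdiv), sub_mul, one_mul, div_mul_cancel₀ _ ha.ne']

variable {U} in
theorem exists_ultraMk_eq_forall_norm_le {x : Ultrapower A U} {r : ℝ} (hr : 0 ≤ r)
    (hx : ‖x‖ ≤ r) : ∃ b : ℕ →ᵇ A, (∀ k, ‖b k‖ ≤ r) ∧ ultraMk U b = x := by
  obtain ⟨a, rfl⟩ := Ideal.Quotient.mk_surjective x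
  choose b hb hab using fun k => exists_norm_le_norm_sub_le (a k) hr
  have hlim := ((tendsto_norm_mk U a).sub_const r).max (tendsto_const_nhds (x := (0 : ℝ)))
  rw [max_eq_right (sub_nonpos.2 hx)] at hlim
  refine ⟨.ofNormedAddCommGroupDiscrete b r hb, hb, Eq.symm (Ideal.Quotient.eq.2 ?_)⟩
  exact squeeze_zero (fun k => norm_nonneg _) hab hlim

-- A sequence of valuations on which `t` is unbounded would be a valuation in the algebra of bounded
-- sequences, where the value of `t` is bounded.
theorem Term.exists_norm_eval_le {n : ℕ} (t : Term n) (r : ℝ) :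
    ∃ C, ∀ v : Fin n → A, (∀ i, ‖v i‖ ≤ r) → ‖t.eval α v‖ ≤ C := by
  by_contra! h
  choose v hvr hv using fun k : ℕ => h k
  let w (i : Fin n) : ℕ →ᵇ A := .ofNormedAddCommGroupDiscrete (v · i) r (hvr · i)
  obtain ⟨k, hk⟩ := exists_nat_ge ‖t.eval (seqAut α) w‖
  have heval : t.eval α (v k) = t.eval (seqAut α) w k :=
    t.eval_comp (α := seqAut α) (seqEval k) (fun _ => rfl) w
  exact (hv k).not_ge (heval ▸ ((t.eval (seqAut α) w).norm_coe_le_norm k).trans hk)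

theorem Formula.exists_eval_mem_Icc {n : ℕ} (φ : Formula n) (r : ℝ) :
    ∃ a b, ∀ v : Fin n → A, (∀ i, ‖v i‖ ≤ r) → φ.eval α v ∈ Set.Icc a b := by
  induction φ generalizing r with
  | norm t =>
    obtain ⟨C, hC⟩ := t.exists_norm_eval_le α r
    exact ⟨0, C, fun v hv => ⟨norm_nonneg _, hC v hv⟩⟩
  | connective f φ ih =>
    choose a b hab using fun i => ih i r
    obtain ⟨C, hC⟩ := (isCompact_univ_pi fun i => isCompact_Icc (a := a i) (b := b i))
      |>.exists_bound_of_continuousOn f.continuous.continuousOn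
    exact ⟨-C, C, fun v hv => abs_le.1 (hC _ fun i _ => hab i v hv)⟩
  | sup N φ ih =>
    obtain ⟨a, b, hab⟩ := ih (max r N)
    exact ⟨a, b, fun v hv => iSup_mem_Icc fun c => hab _ (norm_snoc_le hv c)⟩
  | inf N φ ih =>
    obtain ⟨a, b, hab⟩ := ih (max r N)
    exact ⟨a, b, fun v hv => iInf_mem_Icc fun c => hab _ (norm_snoc_le hv c)⟩

theorem Formula.bddBelow_and_bddAbove_range_eval_snoc {n : ℕ} (φ : Formula (n + 1))
    (v : Fin n → A) (N : ℕ) :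
    BddBelow (Set.range fun a : Metric.closedBall (0 : A) N => φ.eval α (Fin.snoc v (a : A))) ∧
    BddAbove (Set.range fun a : Metric.closedBall (0 : A) N => φ.eval α (Fin.snoc v (a : A))) := by
  obtain ⟨r, hr⟩ := Finite.exists_le fun i => ‖v i‖
  obtain ⟨a, b, hab⟩ := φ.exists_eval_mem_Icc α (max r N)
  exact ⟨⟨a, Set.forall_mem_range.2 fun c => (hab _ (norm_snoc_le hr c)).1⟩,
    ⟨b, Set.forall_mem_range.2 fun c => (hab _ (norm_snoc_le hr c)).2⟩⟩

theorem exists_forall_tendsto_snoc {Z : Type*} [TopologicalSpace Z] {n : ℕ}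
    {F : (Fin (n + 1) → A) → Z} {G : (Fin (n + 1) → Ultrapower A U) → Z}
    (hFG : ∀ v, Tendsto (fun k => F (seqEval k ∘ v)) U (𝓝 (G (ultraMk U ∘ v))))
    (v : Fin n → ℕ →ᵇ A) (N : ℕ) :
    (∀ s : ℕ → Metric.closedBall (0 : A) N, ∃ x : Metric.closedBall (0 : Ultrapower A U) N,
      Tendsto (fun k => F (Fin.snoc (seqEval k ∘ v) (s k : A))) U
        (𝓝 (G (Fin.snoc (ultraMk U ∘ v) (x : Ultrapower A U))))) ∧
    ∀ x : Metric.closedBall (0 : Ultrapower A U) N, ∃ s : ℕ → Metric.closedBall (0 : A) N,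
      Tendsto (fun k => F (Fin.snoc (seqEval k ∘ v) (s k : A))) U
        (𝓝 (G (Fin.snoc (ultraMk U ∘ v) (x : Ultrapower A U)))) := by
  have hlim (b : ℕ →ᵇ A) : Tendsto (fun k => F (Fin.snoc (seqEval k ∘ v) (seqEval k b))) U
      (𝓝 (G (Fin.snoc (ultraMk U ∘ v) (ultraMk U b)))) := by
    simpa only [Fin.comp_snoc] using hFG (Fin.snoc v b)
  refine ⟨fun s => ?_, fun x => ?_⟩
  · have hs (k : ℕ) : ‖(s k : A)‖ ≤ N := mem_closedBall_zero_iff.1 (s k).2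
    let b : ℕ →ᵇ A := .ofNormedAddCommGroupDiscrete (fun k => (s k : A)) N hs
    exact ⟨⟨ultraMk U b, mem_closedBall_zero_iff.2 (norm_ultraMk_le hs)⟩, hlim b⟩
  · obtain ⟨x, hx⟩ := x
    obtain ⟨b, hb, rfl⟩ := exists_ultraMk_eq_forall_norm_le N.cast_nonneg
      (mem_closedBall_zero_iff.1 hx)
    exact ⟨fun k => ⟨b k, mem_closedBall_zero_iff.2 (hb k)⟩, hlim b⟩

theorem Formula.tendsto_eval {n : ℕ} (φ : Formula n) (v : Fin n → ℕ →ᵇ A) :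
    Tendsto (fun k => φ.eval α (seqEval k ∘ v)) U
      (𝓝 (φ.eval (ultrapowerAut U α) (ultraMk U ∘ v))) := by
  induction φ with
  | norm t =>
    have hmk : t.eval (ultrapowerAut U α) (ultraMk U ∘ v) = ultraMk U (t.eval (seqAut α) v) :=
      t.eval_comp (ultraMk U) (fun _ => rfl) v
    have heval (k : ℕ) : t.eval α (seqEval k ∘ v) = t.eval (seqAut α) v k :=
      t.eval_comp (α := seqAut α) (seqEval k) (fun _ => rfl) v
    simp only [Formula.eval, hmk, heval]
    exact tendsto_norm_mk U _
  | connective f φ ih =>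
    exact (f.continuous.tendsto _).comp (tendsto_pi_nhds.2 fun i => ih i v)
  | sup N φ ih =>
    obtain ⟨hs, hx⟩ := exists_forall_tendsto_snoc U ih v N
    exact tendsto_iSup_of_forall_tendsto
      (fun k => (φ.bddBelow_and_bddAbove_range_eval_snoc α _ N).2)
      (φ.bddBelow_and_bddAbove_range_eval_snoc _ _ N).2 hs hx
  | inf N φ ih =>
    obtain ⟨hs, hx⟩ := exists_forall_tendsto_snoc U ih v N
    exact tendsto_iInf_of_forall_tendsto
      (fun k => (φ.bddBelow_and_bddAbove_range_eval_snoc α _ N).1)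
      (φ.bddBelow_and_bddAbove_range_eval_snoc _ _ N).1 hs hx

variable {α} in
theorem Models.ultrapowerAut {T : Set Sentence} (h : Models α T) :
    Models (ultrapowerAut U α) T := by
  intro φ hφ
  refine tendsto_nhds_unique (f := fun _ : ℕ => (0 : ℝ)) (l := U) ?_ tendsto_const_nhds
  simpa only [Subsingleton.elim _ Fin.elim0, h φ hφ] using φ.tendsto_eval α U Fin.elim0

end

section

variable {A B : Type*} [CommCStarAlgebra A] [CommCStarAlgebra B] {α : A ≃⋆ₐ[ℂ] A}
  {β : B ≃⋆ₐ[ℂ] B} (e : A ≃⋆ₐ[ℂ] B)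

/-- The bijection between the closed balls about the origin given by a star isomorphism. -/
def closedBallEquiv (N : ℕ) : Metric.closedBall (0 : A) N ≃ Metric.closedBall (0 : B) N :=
  (EquivLike.toEquiv e).subtypeEquiv fun a => by
    simp only [mem_closedBall_zero_iff, EquivLike.coe_coe, StarAlgEquiv.norm_map]

theorem Formula.eval_comp_equiv (he : ∀ a, e (α a) = β (e a)) {n : ℕ} (φ : Formula n)
    (v : Fin n → A) : φ.eval β (e ∘ v) = φ.eval α v := by
  induction φ with
  | norm t =>
    have heval : t.eval β (e ∘ v) = e (t.eval α v) := t.eval_comp (e : A →⋆ₐ[ℂ] B) he v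
    rw [Formula.eval, Formula.eval, heval, StarAlgEquiv.norm_map]
  | connective f φ ih => simp only [Formula.eval, ih]
  | sup N φ ih =>
    refine ((closedBallEquiv e N).iSup_congr fun a => ?_).symm
    rw [← ih, Fin.comp_snoc]
    rfl
  | inf N φ ih =>
    refine ((closedBallEquiv e N).iInf_congr fun a => ?_).symm
    rw [← ih, Fin.comp_snoc]
    rfl

end

theorem CorrespondsTo.models {A : Type*} [CommCStarAlgebra A] {α : A ≃⋆ₐ[ℂ] A} {Y : Type*}
    [TopologicalSpace Y] [CompactSpace Y] {τ : Y ≃ₜ Y} (hτ : CorrespondsTo α τ) {T : Set Sentence}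
    (h : Models α T) : Models (inducedAut τ) T := by
  obtain ⟨e, he⟩ := hτ
  intro φ hφ
  rw [← h φ hφ, ← φ.eval_comp_equiv e he, Subsingleton.elim (e ∘ _) Fin.elim0]

theorem not_isAxiomatizableOverCantorA :
    ¬IsAxiomatizableOverCantorA.{u} fun _ _ τ => TopLiftingProperty τ := by
  rintro ⟨T, hT⟩
  have hlift := SpiralLimit.topLiftingProperty_shift.{u}
  have hU (n : ℕ) : hyperfilter ℕ ≠ pure n := fun h =>
    (Set.finite_singleton n).notMem_hyperfilter (h ▸ Set.mem_singleton n)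
  obtain ⟨Y, _, _, _, _, _, _, τ, hτ⟩ :=
    exists_ultrapower_correspondsTo SpiralLimit.shift.{u} (hyperfilter ℕ)
  exact hτ.not_topLiftingProperty hlift.1 hU
    ((hT Y τ).1 (hτ.models (((hT _ _).2 hlift).ultrapowerAut _)))

instance {ι : Type*} [Infinite ι] {X : ι → Type*} [∀ i, TopologicalSpace (X i)]
    [∀ i, Nontrivial (X i)] : PerfectSpace (∀ i, X i) := by
  classical
  rw [perfectSpace_iff_forall_not_isolated]
  intro x
  choose y hy using fun i => exists_ne (x i)
  suffices hlim : Tendsto (fun i => Function.update x i (y i)) cofinite (𝓝[≠] x) from hlim.neBot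
  refine tendsto_nhdsWithin_iff.2 ⟨tendsto_pi_nhds.2 fun j => ?_, .of_forall fun i => ?_⟩
  · refine tendsto_const_nhds.congr' ?_
    filter_upwards [eventually_cofinite_ne j] with i hi
    rw [Function.update_of_ne hi.symm]
  · simp [hy]

theorem perfectSpace_of_homeomorph {X Y : Type*} [TopologicalSpace X] [TopologicalSpace Y]
    [PerfectSpace X] (h : X ≃ₜ Y) : PerfectSpace Y := by
  rw [perfectSpace_iff_forall_not_isolated]
  intro y
  rw [← h.apply_symm_apply y, ← h.map_punctured_nhds_eq]
  infer_instance

end CantorDynamics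

end

theorem theorem3p4_general :
    (∀ (X : Type u) [TopologicalSpace X] [CompactSpace X] [T2Space X] [TotallyDisconnectedSpace X]
      [PerfectSpace X] (σ : X ≃ₜ X),
      (∃ n, 1 ≤ n ∧ ∃ φ, CantorDynamics.IsFactorMap σ n φ) →
      ∀ U : Ultrafilter ℕ, (∀ n : ℕ, U ≠ pure n) →
        (∃ (Y : Type u) (_ : TopologicalSpace Y) (_ : CompactSpace Y) (_ : T2Space Y)
            (_ : TotallyDisconnectedSpace Y) (_ : PerfectSpace Y) (τ : Y ≃ₜ Y),
          CantorDynamics.CorrespondsTo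
            (CantorDynamics.ultrapowerAut U (CantorDynamics.inducedAut σ)) τ ∧
          ¬CantorDynamics.TopLiftingProperty τ) ∧
        (∀ (Y : Type v) [TopologicalSpace Y] [CompactSpace Y] [T2Space Y] (τ : Y ≃ₜ Y),
          CantorDynamics.CorrespondsTo
            (CantorDynamics.ultrapowerAut U (CantorDynamics.inducedAut σ)) τ →
          ¬CantorDynamics.TopLiftingProperty τ)) ∧
    ¬CantorDynamics.IsAxiomatizableOverCantorA.{u}
        (fun _ _ τ => CantorDynamics.TopLiftingProperty τ) := by
  refine ⟨fun X _ _ _ _ _ σ hσ U hU => ⟨?_, fun Y _ _ _ τ hτ => hτ.not_topLiftingProperty hσ hU⟩,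
    CantorDynamics.not_isAxiomatizableOverCantorA⟩
  obtain ⟨n, -, φ, hφ⟩ := id hσ
  obtain ⟨x, -⟩ := hφ.2.1 (fun _ => .L₁, .l 0)
  have : Nonempty X := ⟨x⟩
  obtain ⟨Y, _, _, _, _, _, _, τ, hτ⟩ := CantorDynamics.exists_ultrapower_correspondsTo σ U
  exact ⟨Y, _, ‹_›, ‹_›, ‹_›, ‹_›, τ, hτ, hτ.not_topLiftingProperty hσ hU⟩

theorem theorem3p4 :
    (∀ (X : Type u) [MetricSpace X] [CompactSpace X],
      Nonempty (X ≃ₜ (ℕ → Bool)) →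
      ∀ σ : X ≃ₜ X, CantorDynamics.LiftingProperty σ →
      ∀ U : Ultrafilter ℕ, (∀ n : ℕ, U ≠ pure n) →
        (∃ (Y : Type u) (_ : TopologicalSpace Y) (_ : CompactSpace Y) (_ : T2Space Y)
            (_ : TotallyDisconnectedSpace Y) (_ : PerfectSpace Y) (τ : Y ≃ₜ Y),
          CantorDynamics.CorrespondsTo
            (CantorDynamics.ultrapowerAut U (CantorDynamics.inducedAut σ)) τ ∧
          ¬ CantorDynamics.TopLiftingProperty τ) ∧
        (∀ (Y : Type v) [TopologicalSpace Y] [CompactSpace Y] [T2Space Y] (τ : Y ≃ₜ Y),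
          CantorDynamics.CorrespondsTo
            (CantorDynamics.ultrapowerAut U (CantorDynamics.inducedAut σ)) τ →
          ¬ CantorDynamics.TopLiftingProperty τ)) ∧
    ¬ CantorDynamics.IsAxiomatizableOverCantorA.{u}
        (fun _ _ τ => CantorDynamics.TopLiftingProperty τ) := by
  refine ⟨fun X _ _ ⟨h⟩ σ hσ => ?_, theorem3p4_general.{u, v}.2⟩
  have := h.symm.totallyDisconnectedSpace
  have := CantorDynamics.perfectSpace_of_homeomorph h.symm
  exact theorem3p4_general.{u, v}.1 X σ hσ.1
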